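/- **Setting.** A generalized indefinite string of infinite length is given by a real-valued distribution $\omega\in H^{-1}_{\mathrm{loc}}[0,\infty)$ and a non-negative (locally finite) Borel measure $\upsilon$ on $[0,\infty)$. The normalized anti-derivative of $\omega$ is the function $\mathsf w\in L^2_{\mathrm{loc}}[0,\infty)$ with $\omega(h)=-\int_0^\infty \mathsf w(x)h'(x)\,dx$ for all $h\in H^1_{\mathrm c}[0,\infty)$, the functions in $H^1_{\mathrm{loc}}[0,\infty)$ with compact support in $[0,\infty)$. For $z\in\mathbb C$, a solution of $-f''=z\,\omega f+z^2\upsilon f$ is a function $f\in H^1_{\mathrm{loc}}[0,\infty)$ for which there is a (then unique) constant $f'(0-)\in\mathbb C$ with $$f'(0-)h(0)+\int_0^\infty f'(x)h'(x)\,dx=z\,\omega(fh)+z^2\int_{[0,\infty)}fh\,d\upsilon\qquad\text{for all } h\in H^1_{\mathrm c}[0,\infty).$$ Let $\alpha>0$. Suppose that the string belongs to the class $\mathcal F_\alpha$, that is, there is an $R>0$ such that $\mathsf w(x)=\frac{x}{1+2\sqrt\alpha x}$ for almost all $x\geq R$, $\upsilon([R,\infty))=0$, $\mathsf w$ is almost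 everywhere on $[0,R]$ equal to a piecewise constant function (with finitely many pieces), and the support of $\upsilon$ is a finite set. Then for each $k$ with $\operatorname{Im}k>0$ there is a unique solution $f(k,\cdot)$ of the equation with $z=k^2+\alpha$ such that $$f(k,x)=(1+2\sqrt\alpha x)^{\frac{ik}{2\sqrt\alpha}+\frac12},\qquad x\geq R,$$ and the function $$a(k)=\frac{(ik-\sqrt\alpha)f(k,0)+f'(k,0-)}{2ik},\qquad \operatorname{Im}k>0,$$ has a unique analytic continuation to $\mathbb C\setminus\{0\}$, also denoted by $a$. The zeros of $a$ in the open upper half-plane are finite in number and lie on the imaginary axis; let $i\kappa_1,\dots,i\kappa_N$ with $\kappa_n>0$ be these zeros, repeated according to multiplicity. **Lemma 6.1.** One has $\kappa_n\neq\sqrt\alpha$ for all $n$, all integrals below converge absolutely, and $$\frac1{\sqrt\alpha}\sum_{n=1}^N\frac{\kappa_n}{\kappa_n^2-\alpha}+\frac1{2\alpha}\sum_{n=1}^N\log\left|\frac{\kappa_n-\sqrt\alpha}{\kappa_n+\sqrt\alpha}\right|+\frac{\sqrt\alpha}{\pi}\int_{\mathbb R}\frac{1}{(k^2+\alpha)^2}\log|a(k)|\,dk=\int_0^\infty\Bigl(\mathsf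 w(x)-\frac{x}{1+2\sqrt\alpha x}\Bigr)dx$$ and $$\frac1{2\alpha}\sum_{n=1}^N\frac{\kappa_n^3+\alpha\kappa_n}{(\kappa_n^2-\alpha)^2}+\frac1{4\alpha^{3/2}}\sum_{n=1}^N\log\left|\frac{\kappa_n-\sqrt\alpha}{\kappa_n+\sqrt\alpha}\right|+\frac2\pi\int_{\mathbb R}\frac{k^2}{(k^2+\alpha)^3}\log|a(k)|\,dk$$ $$=\int_0^\infty\Bigl|\mathsf w(x)-\frac{x}{1+2\sqrt\alpha x}\Bigr|^2(1+2\sqrt\alpha x)\,dx+\int_{[0,\infty)}(1+2\sqrt\alpha x)\,d\upsilon(x).$$ -/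

import Mathlib

open Set Filter MeasureTheory

noncomputable section

/-- A generalized indefinite string `(L, ω, υ)` of infinite length `L = ∞`. The real-valued
distribution `ω ∈ H⁻¹_loc[0, ∞)` is given by its normalized anti-derivative `w ∈ L²_loc[0, ∞)`
(see `HalfLineString.omega`; this is a one-to-one correspondence when `w` is taken modulo null
sets, and only its values on `[0, ∞)` matter). The non-negative Borel measure `υ` on `[0, ∞)` is a
locally finite measure on `ℝ` without mass on the negative half-line. -/
structure HalfLineString where
  w : ℝ → ℝ
  memLp_w : ∀ b : ℝ, MemLp w 2 (volume.restrict (Icc 0 b))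
  υ : Measure ℝ
  locallyFinite : IsLocallyFiniteMeasure υ
  υ_neg : υ (Iio 0) = 0

/-- `H¹_loc[0, ∞)`: locally absolutely continuous functions with locally square integrable
derivative. -/
def MemH1loc (f : ℝ → ℂ) : Prop :=
  ∀ b : ℝ, 0 ≤ b →
    AbsolutelyContinuousOnInterval f 0 b ∧ MemLp (deriv f) 2 (volume.restrict (Icc 0 b))

/-- `H¹_c[0, ∞)`: functions in `H¹_loc[0, ∞)` with compact support in `[0, ∞)` (such functions and
their derivatives are automatically square integrable). -/
def MemH1c (h : ℝ → ℂ) : Prop :=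
  MemH1loc h ∧ ∃ b : ℝ, ∀ x : ℝ, b ≤ x → h x = 0

namespace HalfLineString

/-- The distribution `ω` with normalized anti-derivative `w`: `ω(h) = -∫₀^∞ w(x) h'(x) dx`
for `h ∈ H¹_c[0, ∞)`. -/
def omega (S : HalfLineString) (h : ℝ → ℂ) : ℂ :=
  -∫ x in Ioi (0 : ℝ), (S.w x : ℂ) * deriv h x

/-- `f` is a (weak) solution of `-f'' = z ω f + z² υ f`, and `d = f'(0-)` is the constant
occurring in the weak formulation. -/
def IsSolution (S : HalfLineString) (z : ℂ) (f : ℝ → ℂ) (d : ℂ) : Prop :=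
  MemH1loc f ∧
  ∀ h : ℝ → ℂ, MemH1c h →
    d * h 0 + ∫ x in Ioi (0 : ℝ), deriv f x * deriv h x =
      z * S.omega (fun x => f x * h x) + z ^ 2 * ∫ x in Ici (0 : ℝ), f x * h x ∂S.υ

/-- `w` is almost everywhere on `[0, R]` equal to a piecewise constant function, with finitely many
pieces `(t i, t (i + 1))`, `i < m`. -/
def IsPiecewiseConst (w : ℝ → ℝ) (R : ℝ) : Prop :=
  ∃ (m : ℕ) (t c : ℕ → ℝ), Monotone t ∧ t 0 = 0 ∧ t m = R ∧
    ∀ i < m, ∀ᵐ x ∂volume.restrict (Ioo (t i) (t (i + 1))), w x = c i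

/-- The string `S` belongs to the class `𝓕_α`, as witnessed by the number `R > 0`. -/
structure MemClassF (S : HalfLineString) (α R : ℝ) : Prop where
  R_pos : 0 < R
  w_eq : ∀ᵐ x ∂volume.restrict (Ici R), S.w x = x / (1 + 2 * √α * x)
  υ_eq : S.υ (Ici R) = 0
  piecewiseConst : IsPiecewiseConst S.w R
  support_finite : S.υ.support.Finite

/-- `f` is the Jost solution `f(k, ·)`, and `d = f'(k, 0-)`. -/
def IsJostSolution (S : HalfLineString) (α R : ℝ) (k : ℂ) (f : ℝ → ℂ) (d : ℂ) : Prop :=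
  S.IsSolution (k ^ 2 + α) f d ∧
  ∀ x : ℝ, R ≤ x →
    f x = ((1 + 2 * √α * x : ℝ) : ℂ) ^ (Complex.I * k / (2 * (√α : ℂ)) + 1 / 2)

/-- `a` is the function given on the upper half-plane by
`a(k) = ((i k - √α) f(k, 0) + f'(k, 0-)) / (2 i k)`, where `f(k, ·)` is the Jost solution, and
analytically continued to `ℂ \ {0}`. The value of `a` at `0` is irrelevant. -/
structure IsJostFunction (S : HalfLineString) (α R : ℝ) (a : ℂ → ℂ) : Prop where
  analytic : AnalyticOnNhd ℂ a {0}ᶜ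
  exists_jost : ∀ k : ℂ, 0 < k.im → ∃ (f : ℝ → ℂ) (d : ℂ), S.IsJostSolution α R k f d
  eq_jost : ∀ k : ℂ, 0 < k.im → ∀ (f : ℝ → ℂ) (d : ℂ), S.IsJostSolution α R k f d →
    a k = ((Complex.I * k - √α) * f 0 + d) / (2 * Complex.I * k)

end HalfLineString

/-- The numbers `i κ₁, …, i κ_N` with `κₙ > 0` are precisely the zeros of `a` in the open upper
half-plane, each repeated according to its multiplicity. -/
def IsUpperZeroEnumeration (a : ℂ → ℂ) {N : ℕ} (κ : Fin N → ℝ) : Prop :=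
  (∀ n, 0 < κ n) ∧
  ∀ k : ℂ, 0 < k.im →
    analyticOrderAt a k = (Nat.card {n : Fin N // Complex.I * (κ n : ℂ) = k} : ℕ∞)

end

/-! Put c = √α and σ = ik/(2c) + 1/2. Then z = k² + α = 4c²(σ - σ²), the upper half-plane becomes Re
σ < 1/2, the real line becomes Re σ = 1/2, and k = i√α becomes σ = 0, where z vanishes. The trace
formulas are Jensen-type formulas for `a`, expanded to second order at this point.

On [0, R] a solution is piecewise affine, and its value and quasi-derivative f' + z w f pass from
node to node by maps polynomial in z. Starting from (1 + 2cR)^σ at R and going back to 0 gives 2ik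
a(k) = (1 + 2cR)^σ Q(σ) with a real polynomial Q (`jostPoly`). This yields the continuation of `a`.
A monotonicity argument for Im(conj f · g / z), with g the quasi-derivative, forces the roots of Q
in Re σ < 1/2 to be real (`im_eq_zero`); they are σ = (c - κ)/(2c).

On the line k = ct, log|a| is a constant plus log|Q(σ)| - log|σ - 1/2|, and log|Q| splits over the
roots ρ. The Möbius map w = 1 - 1/σ turns the line into the unit circle and the two weights into
multiples of 1 - Re w and 1 - Re w², so that each log|σ - ρ| is integrated by means of the Fourier
coefficients of log|w - v|, |v| ≤ 1 (`integral_kernel_log_norm_line`,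
`integral_kernel_sq_log_norm_line`). Roots with Re ρ < 1/2 are first reflected in the line. This
leaves sums over all roots of log|ρ|, Re 1/ρ and Re 1/ρ², plus reflection corrections, which are the
terms in κ.

The sums over all roots are determined by the first three Taylor coefficients of Q at 0. At z = 0
solutions are explicit, and the perturbation to second order telescopes along the nodes into the
integrals of w and υ on the right-hand sides (`coeff_one_eq`, `coeff_two_eq`). As Q(0) = -2c ≠ 0, no
κ equals c. -/

/-! ### Fourier coefficients of log|w - v| on the unit circle. -/

section CircleFourier

open Complex Metric Topology Real

lemma circleAverage_mul_pow_eq_zero {f : ℂ → ℂ} (hf : DiffContOnCl ℂ f (ball 0 1)) {n : ℕ}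
    (hn : n ≠ 0) : Real.circleAverage (fun w => f w * w ^ n) 0 1 = 0 := by
  have h : DiffContOnCl ℂ (fun w => f w * w ^ n) (ball 0 |1|) := by
    rw [abs_one]
    have hp : DiffContOnCl ℂ (fun w : ℂ => w ^ n) (ball 0 1) :=
      Differentiable.diffContOnCl (by fun_prop)
    exact hf.smul hp
  rw [h.circleAverage]
  simp [hn]

lemma circleAverage_mul_inv_pow {f : ℂ → ℂ} (hf : DiffContOnCl ℂ f (ball 0 1)) (n : ℕ) :
    Real.circleAverage (fun w => f w * (w ^ n)⁻¹) 0 1 = iteratedDeriv n f 0 / n.factorial := by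
  have h := DiffContOnCl.circleIntegral_one_div_sub_center_pow_smul one_pos n hf
  rw [Real.circleAverage_eq_circleIntegral one_ne_zero]
  have h2 : (∮ z in C(0, 1), (z - 0)⁻¹ • (f z * (z ^ n)⁻¹))
      = ∮ z in C(0, 1), (1 / (z - 0) ^ (n + 1)) • f z := by
    apply circleIntegral.integral_congr zero_le_one
    intro z hz
    simp only [sub_zero, smul_eq_mul, pow_succ, one_div, mul_inv]
    ring
  rw [h2, h]
  simp only [smul_eq_mul]
  field_simp

lemma one_sub_mul_mem_slitPlane {u w : ℂ} (hu : ‖u‖ < 1) (hw : ‖w‖ ≤ 1) :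
    1 - u * w ∈ slitPlane := by
  left
  have h1 : (u * w).re ≤ ‖u * w‖ := re_le_norm _
  have h2 : ‖u * w‖ ≤ ‖u‖ * 1 := by rw [norm_mul]; gcongr
  simp only [sub_re, one_re]
  linarith

lemma diffContOnCl_log_one_sub {u : ℂ} (hu : ‖u‖ < 1) :
    DiffContOnCl ℂ (fun w => Complex.log (1 - u * w)) (ball 0 1) := by
  apply DifferentiableOn.diffContOnCl
  rw [closure_ball _ one_ne_zero]
  intro w hw
  have := one_sub_mul_mem_slitPlane hu (by simpa using hw)
  have hd : DifferentiableAt ℂ (fun w => 1 - u * w) w := by fun_prop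
  exact (hd.clog this).differentiableWithinAt

lemma iteratedDeriv_one_log_one_sub (u : ℂ) :
    iteratedDeriv 1 (fun w => Complex.log (1 - u * w)) 0 = -u := by
  rw [iteratedDeriv_one]
  have : HasDerivAt (fun w : ℂ => 1 - u * w) (-u) 0 := by
    simpa using ((hasDerivAt_id (0:ℂ)).const_mul u).const_sub 1
  have := this.clog (by simp)
  simpa using this.deriv

lemma iteratedDeriv_two_log_one_sub {u : ℂ} (hu : ‖u‖ < 1) :
    iteratedDeriv 2 (fun w => Complex.log (1 - u * w)) 0 = -u ^ 2 := by
  rw [iteratedDeriv_succ, iteratedDeriv_one]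
  have h : deriv (fun w => Complex.log (1 - u * w)) =ᶠ[𝓝 0] fun w => -u / (1 - u * w) := by
    filter_upwards [ball_mem_nhds (0:ℂ) one_pos] with w hw
    have hm := one_sub_mul_mem_slitPlane hu (by simpa using (mem_ball_zero_iff.1 hw).le)
    have : HasDerivAt (fun w : ℂ => 1 - u * w) (-u) w := by
      simpa using ((hasDerivAt_id w).const_mul u).const_sub 1
    exact (this.clog hm).deriv
  rw [h.deriv_eq]
  have h1 : HasDerivAt (fun w : ℂ => 1 - u * w) (-u) 0 := by
    simpa using ((hasDerivAt_id (0:ℂ)).const_mul u).const_sub 1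
  have := (hasDerivAt_const (0:ℂ) (-u)).div h1 (by simp)
  have h2 := this.deriv
  simp only [mul_zero, sub_zero] at h2
  refine Eq.trans h2 ?_
  ring

/-- For |v| < 1 this trades w - v, which vanishes inside the disc, for a function that has a
holomorphic logarithm there. -/
lemma norm_sub_eq_norm_one_sub_conj_mul {v w : ℂ} (hw : ‖w‖ = 1) :
    ‖w - v‖ = ‖1 - starRingEnd ℂ v * w‖ := by
  have h1 : starRingEnd ℂ w * w = 1 := by rw [conj_mul', hw]; simp
  have h2 : 1 - starRingEnd ℂ v * w = starRingEnd ℂ (w - v) * w := by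
    rw [map_sub, sub_mul, h1]
  rw [h2, norm_mul, hw, mul_one, RCLike.norm_conj]

lemma re_mul_re_of_norm_eq_one (L : ℂ) {w : ℂ} (hw : ‖w‖ = 1) (n : ℕ) :
    L.re * (w ^ n).re = ((L * w ^ n + L * (w ^ n)⁻¹) / 2).re := by
  have h1 : (w ^ n)⁻¹ = starRingEnd ℂ (w ^ n) := by
    rw [Complex.inv_def, Complex.normSq_eq_norm_sq, norm_pow, hw]; simp
  rw [h1]
  generalize w ^ n = p
  simp

/-- On the circle log|w - v| is the real part of L(w) = log(1 - conj v · w) and Re wⁿ = (wⁿ +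
w⁻ⁿ)/2. The average of L wⁿ vanishes by the mean value property, and that of L w⁻ⁿ is the n-th
Taylor coefficient of L. -/
lemma circleAverage_log_norm_sub_mul_re_pow_of_norm_lt {v : ℂ} (hv : ‖v‖ < 1) {n : ℕ}
    (hn : n ≠ 0) {d : ℂ}
    (hd : iteratedDeriv n (fun w => Complex.log (1 - starRingEnd ℂ v * w)) 0 / n.factorial = d) :
    Real.circleAverage (fun w => Real.log ‖w - v‖ * (w ^ n).re) 0 1 = d.re / 2 := by
  have hv' : ‖starRingEnd ℂ v‖ < 1 := by rwa [RCLike.norm_conj]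
  have hL := diffContOnCl_log_one_sub hv'
  set L : ℂ → ℂ := fun w => Complex.log (1 - starRingEnd ℂ v * w) with hLdef
  have hc : ContinuousOn L (sphere 0 |1|) := by
    have := hL.continuousOn_ball
    rw [abs_one]
    exact this.mono sphere_subset_closedBall
  have hpow0 : ∀ w ∈ sphere (0:ℂ) |1|, w ^ n ≠ 0 := by
    intro w hw
    have : w ≠ 0 := by rintro rfl; simp at hw
    exact pow_ne_zero _ this
  have hi1 : CircleIntegrable (fun w => L w * w ^ n) 0 1 :=
    ContinuousOn.circleIntegrable' (hc.mul (by fun_prop))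
  have hi2 : CircleIntegrable (fun w => L w * (w ^ n)⁻¹) 0 1 :=
    ContinuousOn.circleIntegrable' (hc.mul (ContinuousOn.inv₀ (by fun_prop) hpow0))
  have h1 : Real.circleAverage (fun w => Real.log ‖w - v‖ * (w ^ n).re) 0 1
      = Real.circleAverage (reCLM ∘ fun w => (2:ℂ)⁻¹ • (L w * w ^ n + L w * (w ^ n)⁻¹)) 0 1 := by
    apply Real.circleAverage_congr_sphere
    intro w hw
    have hw1 : ‖w‖ = 1 := by simpa using hw
    simp only [Function.comp, reCLM_apply, smul_eq_mul]
    rw [norm_sub_eq_norm_one_sub_conj_mul hw1, ← Complex.log_re, re_mul_re_of_norm_eq_one _ hw1]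
    congr 1
    ring
  rw [h1, ContinuousLinearMap.circleAverage_comp_comm, Real.circleAverage_fun_smul,
    Real.circleAverage_fun_add hi1 hi2, circleAverage_mul_pow_eq_zero hL hn,
    circleAverage_mul_inv_pow hL n, hd]
  · simp; ring
  · exact (hi1.add hi2).const_smul

/-- Allows |v| = 1, where the logarithm is singular on the circle, by approaching v radially from
inside. -/
lemma tendsto_circleAverage_log_norm_sub_mul {v : ℂ} (hv : ‖v‖ ≤ 1) {K : ℂ → ℝ}
    (hK : Continuous K) :
    Tendsto (fun r : ℝ => Real.circleAverage (fun w => Real.log ‖w - r * v‖ * K w) 0 1) (𝓝[<] 1)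
      (𝓝 (Real.circleAverage (fun w => Real.log ‖w - v‖ * K w) 0 1)) := by
  have hKc : Continuous fun θ : ℝ => K (circleMap 0 1 θ) := by fun_prop
  have hr1 : ∀ᶠ r : ℝ in 𝓝[<] 1, r ∈ Ioo (0:ℝ) 1 := Ioo_mem_nhdsLT one_pos
  have hae : ∀ᵐ θ : ℝ, circleMap 0 1 θ ≠ v := by
    have := (countable_singleton v).preimage_circleMap 0 (one_ne_zero)
    exact measure_eq_zero_iff_ae_notMem.1 (this.measure_zero volume)
  apply Filter.Tendsto.smul tendsto_const_nhds _
  apply intervalIntegral.tendsto_integral_filter_of_dominated_convergence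
    -- The majorant comes from |w - v|/2 ≤ |w - rv| ≤ 2: since |w - rv| ≥ 1 - r, moving from rv to v
    -- at most doubles the distance to w.
    (fun θ => (Real.log 2 + |Real.log ‖circleMap 0 1 θ - v‖|) * |K (circleMap 0 1 θ)|)
  · filter_upwards with r
    apply Measurable.aestronglyMeasurable
    have : Measurable fun θ : ℝ => ‖circleMap 0 1 θ - r * v‖ :=
      (Continuous.norm (by fun_prop)).measurable
    exact (Real.measurable_log.comp this).mul hKc.measurable
  · filter_upwards [hr1] with r hr
    filter_upwards [hae] with θ hθ _
    rw [norm_mul, Real.norm_eq_abs, Real.norm_eq_abs]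
    gcongr
    set w := circleMap 0 1 θ
    have hw : ‖w‖ = 1 := by simp [w]
    have h0 : 0 < ‖w - v‖ := norm_pos_iff.2 (sub_ne_zero.2 hθ)
    have hrv : ‖(r:ℂ) * v‖ ≤ r := by
      rw [norm_mul, Complex.norm_real, Real.norm_of_nonneg hr.1.le]
      nlinarith [hr.1]
    have h1 : 1 - r ≤ ‖w - r * v‖ := by
      have := norm_sub_norm_le w (r * v)
      linarith
    have h2 : ‖w - v‖ ≤ ‖w - r * v‖ + (1 - r) := by
      have e : w - v = (w - r * v) - ((1 - r : ℝ) : ℂ) * v := by push_cast; ring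
      rw [e]
      refine (norm_sub_le _ _).trans ?_
      gcongr
      rw [norm_mul, Complex.norm_real, Real.norm_of_nonneg (by linarith [hr.2])]
      nlinarith [hr.2]
    have h3 : ‖w - r * v‖ ≤ 2 := by
      refine (norm_sub_le _ _).trans ?_
      linarith [hr.2]
    have h4 : 0 < ‖w - r * v‖ := by linarith [hr.2]
    rw [abs_le]
    constructor
    · have : Real.log ‖w - v‖ ≤ Real.log (2 * ‖w - r * v‖) := Real.log_le_log h0 (by linarith)
      rw [Real.log_mul two_ne_zero h4.ne'] at this
      linarith [neg_abs_le (Real.log ‖w - v‖)]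
    · have := Real.log_le_log h4 h3
      linarith [abs_nonneg (Real.log ‖w - v‖)]
  · apply IntervalIntegrable.mul_continuousOn _ (by fun_prop)
    apply IntervalIntegrable.add (by simp)
    exact .abs <| MeromorphicOn.circleIntegrable_log_norm (f := fun z ↦ z - v) (by intro; fun_prop)
  · filter_upwards [hae] with θ hθ _
    apply Tendsto.mul_const
    have h0 : ‖circleMap 0 1 θ - v‖ ≠ 0 := norm_ne_zero_iff.2 (sub_ne_zero.2 hθ)
    have : ContinuousAt (fun r : ℝ => Real.log ‖circleMap 0 1 θ - r * v‖) 1 := by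
      apply ContinuousAt.log (by fun_prop)
      simpa using h0
    have := this.tendsto
    simp only [ofReal_one, one_mul] at this
    exact this.mono_left nhdsWithin_le_nhds

lemma circleAverage_log_norm_sub_mul_re_pow {v : ℂ} (hv : ‖v‖ ≤ 1) {n : ℕ} (hn : n ≠ 0)
    (hd : ∀ u : ℂ, ‖u‖ < 1 →
      iteratedDeriv n (fun w => Complex.log (1 - u * w)) 0 / n.factorial = -u ^ n / n) :
    Real.circleAverage (fun w => Real.log ‖w - v‖ * (w ^ n).re) 0 1
      = -(v ^ n).re / (2 * n) := by
  have h1 := tendsto_circleAverage_log_norm_sub_mul hv (K := fun w => (w ^ n).re) (by fun_prop)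
  have h2 : Tendsto (fun r : ℝ => -((r * v : ℂ) ^ n).re / (2 * n)) (𝓝[<] 1)
      (𝓝 (-(v ^ n).re / (2 * n))) := by
    have : ContinuousAt (fun r : ℝ => -((r * v : ℂ) ^ n).re / (2 * n)) 1 := by fun_prop
    have := this.tendsto
    simp only [ofReal_one, one_mul] at this
    exact this.mono_left nhdsWithin_le_nhds
  refine tendsto_nhds_unique h1 (h2.congr' ?_)
  filter_upwards [Ioo_mem_nhdsLT (zero_lt_one' ℝ)] with r hr
  have hrv : ‖(r:ℂ) * v‖ < 1 := by
    rw [norm_mul, Complex.norm_real, Real.norm_of_nonneg hr.1.le]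
    nlinarith [hr.1, hr.2]
  rw [circleAverage_log_norm_sub_mul_re_pow_of_norm_lt hrv hn
    (hd _ (by rwa [RCLike.norm_conj]))]
  rw [← map_pow, ← map_neg, ← Complex.ofReal_natCast, Complex.div_ofReal_re, conj_re, neg_re]
  rw [div_div, mul_comm (n:ℝ) 2]

lemma circleAverage_log_norm_sub_mul_re {v : ℂ} (hv : ‖v‖ ≤ 1) :
    Real.circleAverage (fun w => Real.log ‖w - v‖ * w.re) 0 1 = -v.re / 2 := by
  have := circleAverage_log_norm_sub_mul_re_pow hv one_ne_zero fun u _ => by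
    rw [iteratedDeriv_one_log_one_sub]; simp
  simpa using this

lemma circleAverage_log_norm_sub_mul_re_sq {v : ℂ} (hv : ‖v‖ ≤ 1) :
    Real.circleAverage (fun w => Real.log ‖w - v‖ * (w ^ 2).re) 0 1 = -(v ^ 2).re / 4 := by
  have := circleAverage_log_norm_sub_mul_re_pow hv two_ne_zero fun u hu => by
    rw [iteratedDeriv_two_log_one_sub hu]; simp
  rw [this]; norm_num

lemma circleAverage_log_norm_sub_eq_zero {v : ℂ} (hv : ‖v‖ ≤ 1) :
    Real.circleAverage (fun w => Real.log ‖w - v‖) 0 1 = 0 := by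
  rw [circleAverage_log_norm_sub_const_eq_posLog, Real.posLog_eq_zero_iff]
  rwa [abs_norm]

end CircleFourier

/-! ### Logarithmic integrals over the line Re σ = 1/2, moved to the unit circle. -/

section LineIntegrals

open Complex Real

/-- The parametrization `θ ↦ cot (θ / 2)` of the real line by the punctured circle. -/
noncomputable def cayleyLine (θ : ℝ) : ℝ := Real.tan ((π - θ) / 2)

lemma cos_half_pos {θ : ℝ} (hθ : θ ∈ Ioo 0 (2 * π)) : 0 < Real.cos ((π - θ) / 2) :=
  Real.cos_pos_of_mem_Ioo ⟨by linarith [hθ.2], by linarith [hθ.1]⟩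

lemma one_add_cayleyLine_sq {θ : ℝ} (hθ : θ ∈ Ioo 0 (2 * π)) :
    1 + cayleyLine θ ^ 2 = (Real.cos ((π - θ) / 2) ^ 2)⁻¹ := by
  have := cos_half_pos hθ
  rw [cayleyLine, ← Real.inv_one_add_tan_sq this.ne', inv_inv]

lemma cos_half_sq (θ : ℝ) : Real.cos ((π - θ) / 2) ^ 2 = (1 - Real.cos θ) / 2 := by
  rw [Real.cos_sq, show 2 * ((π - θ) / 2) = π - θ by ring, Real.cos_pi_sub]; ring

lemma hasDerivAt_cayleyLine {θ : ℝ} (hθ : θ ∈ Ioo 0 (2 * π)) :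
    HasDerivAt cayleyLine (-((1 + cayleyLine θ ^ 2) / 2)) θ := by
  have h1 : HasDerivAt (fun θ : ℝ => (π - θ) / 2) (-1 / 2) θ :=
    ((hasDerivAt_id θ).const_sub π).div_const 2
  have h2 := (Real.hasDerivAt_tan (cos_half_pos hθ).ne').comp θ h1
  rw [one_add_cayleyLine_sq hθ]
  convert! h2 using 1
  ring

lemma injOn_cayleyLine : InjOn cayleyLine (Ioo 0 (2 * π)) := by
  intro x hx y hy h
  have := Real.injOn_tan (x₁ := (π - x) / 2) (x₂ := (π - y) / 2)
    ⟨by linarith [hx.2], by linarith [hx.1]⟩ ⟨by linarith [hy.2], by linarith [hy.1]⟩ h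
  linarith

lemma image_cayleyLine : cayleyLine '' Ioo 0 (2 * π) = univ := by
  refine eq_univ_of_forall fun t => ⟨π - 2 * Real.arctan t, ⟨?_, ?_⟩, ?_⟩
  · linarith [Real.arctan_lt_pi_div_two t]
  · linarith [Real.neg_pi_div_two_lt_arctan t]
  · rw [cayleyLine, show (π - (π - 2 * Real.arctan t)) / 2 = Real.arctan t by ring, Real.tan_arctan]

lemma abs_deriv_cayleyLine (θ : ℝ) :
    |(-((1 + cayleyLine θ ^ 2) / 2))| = (1 + cayleyLine θ ^ 2) / 2 := by
  rw [abs_neg, abs_of_nonneg (by positivity)]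

lemma integrable_iff_integrableOn_cayleyLine (F : ℝ → ℝ) :
    Integrable F ↔
      IntegrableOn (fun θ => (1 + cayleyLine θ ^ 2) / 2 * F (cayleyLine θ)) (Ioo 0 (2 * π)) := by
  have := integrableOn_image_iff_integrableOn_abs_deriv_smul measurableSet_Ioo
    (fun θ hθ => (hasDerivAt_cayleyLine hθ).hasDerivWithinAt) injOn_cayleyLine F
  rw [image_cayleyLine, integrableOn_univ] at this
  simpa only [abs_deriv_cayleyLine, smul_eq_mul] using this

lemma integral_eq_integral_cayleyLine (F : ℝ → ℝ) :
    ∫ t, F t = ∫ θ in Ioo 0 (2 * π), (1 + cayleyLine θ ^ 2) / 2 * F (cayleyLine θ) := by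
  have := integral_image_eq_integral_abs_deriv_smul measurableSet_Ioo
    (fun θ hθ => (hasDerivAt_cayleyLine hθ).hasDerivWithinAt) injOn_cayleyLine F
  rw [image_cayleyLine, Measure.restrict_univ] at this
  simpa only [abs_deriv_cayleyLine, smul_eq_mul] using this

lemma one_sub_circleMap_ne_zero {θ : ℝ} (hθ : θ ∈ Ioo 0 (2 * π)) : 1 - circleMap 0 1 θ ≠ 0 := by
  intro h
  have h1 := congrArg Complex.re h
  simp only [circleMap, ofReal_one, zero_add, one_mul, sub_re, one_re, zero_re,
    Complex.exp_ofReal_mul_I_re] at h1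
  have h2 := cos_half_sq θ
  have := cos_half_pos hθ
  rw [h1] at h2
  nlinarith

lemma cayleyLine_eq_inv {θ : ℝ} (hθ : θ ∈ Ioo 0 (2 * π)) :
    (1 + I * cayleyLine θ) / 2 = (1 - circleMap 0 1 θ)⁻¹ := by
  have h0 := one_sub_circleMap_ne_zero hθ
  have hc : (Real.cos ((π - θ) / 2) : ℂ) ≠ 0 := by exact_mod_cast (cos_half_pos hθ).ne'
  -- With β = (π - θ)/2 one has exp(iθ) = -exp(-iβ)², hence 1 - exp(iθ) = 2 cos β exp(-iβ), whose
  -- inverse is (1 + i tan β)/2.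
  have h1 : circleMap 0 1 θ = -(Complex.cos ((π - θ) / 2) - Complex.sin ((π - θ) / 2) * I) ^ 2 := by
    rw [circleMap]
    have : (Complex.cos ((π - θ) / 2) - Complex.sin ((π - θ) / 2) * I)
      = Complex.exp (-((π - θ) / 2) * I) := by
      rw [Complex.exp_mul_I, Complex.cos_neg, Complex.sin_neg]; ring
    rw [this, ← Complex.exp_nat_mul]
    have e : ((2:ℕ):ℂ) * (-((π - θ) / 2) * I) = θ * I + -(π * I) := by push_cast; ring
    rw [e, Complex.exp_add, Complex.exp_neg, Complex.exp_pi_mul_I]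
    push_cast; ring
  have h2 := Complex.sin_sq_add_cos_sq ((π - θ) / 2 : ℂ)
  refine eq_inv_of_mul_eq_one_left ?_
  rw [cayleyLine, h1, Real.tan_eq_sin_div_cos]
  push_cast at hc ⊢
  set C := Complex.cos ((π - θ) / 2)
  set D := Complex.sin ((π - θ) / 2)
  have h3 : 1 - -(C - D * I) ^ 2 = 2 * C * (C - D * I) := by
    linear_combination D ^ 2 * I_sq - h2
  have h4 : (1 + I * (D / C)) / 2 * (2 * C * (C - D * I)) = (C + I * D) * (C - D * I) := by
    field_simp
  rw [h3, h4]
  linear_combination -D ^ 2 * I_sq + h2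

/-- With σ = 1/(1 - w) one has σ - ρ = ρ (w - (1 - 1/ρ))/(1 - w): the zero ρ moves to 1 - 1/ρ, and
the pole at infinity moves to w = 1. -/
lemma log_norm_cayleyLine_sub {ρ : ℂ} (hρ : ρ ≠ 0) {θ : ℝ} (hθ : θ ∈ Ioo 0 (2 * π))
    (hne : circleMap 0 1 θ ≠ 1 - ρ⁻¹) :
    Real.log ‖(1 + I * cayleyLine θ) / 2 - ρ‖ = Real.log ‖ρ‖
      + Real.log ‖circleMap 0 1 θ - (1 - ρ⁻¹)‖ - Real.log ‖circleMap 0 1 θ - 1‖ := by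
  have h0 := one_sub_circleMap_ne_zero hθ
  rw [cayleyLine_eq_inv hθ]
  set w := circleMap 0 1 θ
  have h1 : w - 1 ≠ 0 := by rw [← neg_sub]; exact neg_ne_zero.2 h0
  have h2 : w - (1 - ρ⁻¹) ≠ 0 := sub_ne_zero.2 hne
  have h3 : (1 - w)⁻¹ - ρ = -(ρ * (w - (1 - ρ⁻¹)) / (w - 1)) := by
    field_simp
    ring
  rw [h3, norm_neg, norm_div, norm_mul,
    Real.log_div (by positivity) (by positivity), Real.log_mul (by positivity) (by positivity)]

/-- In the half-plane Re ρ ≥ 1/2 the point 1 is at least as close to ρ as 0 is. -/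
lemma norm_one_sub_inv_le_one {ρ : ℂ} (hρ : 1 / 2 ≤ ρ.re) : ‖1 - ρ⁻¹‖ ≤ 1 := by
  have h0 : ρ ≠ 0 := by rintro rfl; norm_num at hρ
  have : 1 - ρ⁻¹ = (ρ - 1) / ρ := by field_simp
  rw [this, norm_div, div_le_one (norm_pos_iff.2 h0), ← sq_le_sq₀ (norm_nonneg _) (norm_nonneg _),
    ← Complex.normSq_eq_norm_sq, ← Complex.normSq_eq_norm_sq, Complex.normSq_apply,
    Complex.normSq_apply]
  simp
  nlinarith

lemma circleIntegrable_log_norm_sub_mul (v : ℂ) {K : ℂ → ℝ} (hK : Continuous K) :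
    CircleIntegrable (fun w => Real.log ‖w - v‖ * K w) 0 1 :=
  IntervalIntegrable.mul_continuousOn (circleIntegrable_log_norm_sub_const 1)
    (by fun_prop)

lemma integral_log_norm_line {ρ : ℂ} (hρ : 1 / 2 ≤ ρ.re) {k : ℝ → ℝ} {K : ℂ → ℝ}
    (hK : Continuous K)
    (hkK : ∀ θ ∈ Ioo 0 (2 * π),
      (1 + cayleyLine θ ^ 2) / 2 * k (cayleyLine θ) = K (circleMap 0 1 θ)) :
    Integrable (fun t : ℝ => k t * Real.log ‖(1 + I * t) / 2 - ρ‖) ∧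
    ∫ t : ℝ, k t * Real.log ‖(1 + I * t) / 2 - ρ‖ = 2 * π * (
      Real.log ‖ρ‖ * Real.circleAverage K 0 1
      + Real.circleAverage (fun w => Real.log ‖w - (1 - ρ⁻¹)‖ * K w) 0 1
      - Real.circleAverage (fun w => Real.log ‖w - 1‖ * K w) 0 1) := by
  have h0 : ρ ≠ 0 := by rintro rfl; norm_num at hρ
  have hi0 : CircleIntegrable (fun w => Real.log ‖ρ‖ * K w) 0 1 :=
    (ContinuousOn.circleIntegrable' (by fun_prop))
  have hi1 := circleIntegrable_log_norm_sub_mul (1 - ρ⁻¹) hK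
  have hi2 := circleIntegrable_log_norm_sub_mul 1 hK
  set H : ℂ → ℝ := fun w => Real.log ‖ρ‖ * K w + Real.log ‖w - (1 - ρ⁻¹)‖ * K w
    - Real.log ‖w - 1‖ * K w with hH
  have hHi : CircleIntegrable H 0 1 := (hi0.add hi1).sub hi2
  have hae : ∀ᵐ θ : ℝ ∂volume.restrict (Ioo 0 (2 * π)),
      H (circleMap 0 1 θ) = (1 + cayleyLine θ ^ 2) / 2 *
        (k (cayleyLine θ) * Real.log ‖(1 + I * cayleyLine θ) / 2 - ρ‖) := by
    have hne : ∀ᵐ θ : ℝ, circleMap 0 1 θ ≠ 1 - ρ⁻¹ := by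
      have := (countable_singleton (1 - ρ⁻¹)).preimage_circleMap 0 (one_ne_zero)
      exact measure_eq_zero_iff_ae_notMem.1 (this.measure_zero volume)
    filter_upwards [ae_restrict_mem measurableSet_Ioo, ae_restrict_of_ae hne] with θ hθ hn
    rw [← mul_assoc, hkK θ hθ, log_norm_cayleyLine_sub h0 hθ hn, hH]
    ring
  have hHi' : IntegrableOn (fun θ => H (circleMap 0 1 θ)) (Ioo 0 (2 * π)) := by
    have : IntervalIntegrable (fun θ => H (circleMap 0 1 θ)) volume 0 (2 * π) := hHi
    rw [intervalIntegrable_iff_integrableOn_Ioo_of_le (by positivity)] at this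
    exact this
  constructor
  · rw [integrable_iff_integrableOn_cayleyLine]
    exact hHi'.congr hae
  · rw [integral_eq_integral_cayleyLine, ← integral_congr_ae hae]
    have e1 : Real.circleAverage H 0 1 = Real.log ‖ρ‖ * Real.circleAverage K 0 1
      + Real.circleAverage (fun w => Real.log ‖w - (1 - ρ⁻¹)‖ * K w) 0 1
      - Real.circleAverage (fun w => Real.log ‖w - 1‖ * K w) 0 1 := by
      rw [hH, Real.circleAverage_fun_sub (f₁ := fun w => Real.log ‖ρ‖ * K w
        + Real.log ‖w - (1 - ρ⁻¹)‖ * K w) (hi0.add hi1) hi2, Real.circleAverage_fun_add hi0 hi1]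
      congr 2
      exact Real.circleAverage_fun_smul (a := Real.log ‖ρ‖)
    rw [← e1, Real.circleAverage_def, smul_eq_mul, intervalIntegral.integral_of_le (by positivity),
      integral_Ioc_eq_integral_Ioo]
    field_simp

/-- Multiplied by the Jacobian, the weight becomes a trigonometric polynomial, so only the mean and
the first Fourier coefficient of the logarithm enter. -/
lemma kernel_cayleyLine {θ : ℝ} (hθ : θ ∈ Ioo 0 (2 * π)) :
    (1 + cayleyLine θ ^ 2) / 2 * (1 / (1 + cayleyLine θ ^ 2) ^ 2)
      = (1 - (circleMap 0 1 θ).re) / 4 := by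
  have h1 := one_add_cayleyLine_sq hθ
  rw [h1, cos_half_sq]
  have h2 := cos_half_pos hθ
  have h3 := cos_half_sq θ
  have h4 : 0 < (1 - Real.cos θ) / 2 := by rw [← h3]; positivity
  have h5 : (circleMap 0 1 θ).re = Real.cos θ := by
    simp [circleMap, Complex.exp_ofReal_mul_I_re]
  rw [h5]
  field_simp
  norm_num

/-- Here only the mean and the second Fourier coefficient survive. -/
lemma kernel_sq_cayleyLine {θ : ℝ} (hθ : θ ∈ Ioo 0 (2 * π)) :
    (1 + cayleyLine θ ^ 2) / 2 * (cayleyLine θ ^ 2 / (1 + cayleyLine θ ^ 2) ^ 3)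
      = (1 - ((circleMap 0 1 θ) ^ 2).re) / 16 := by
  have h1 := one_add_cayleyLine_sq hθ
  have h2 := cos_half_pos hθ
  have h3 := cos_half_sq θ
  have h4 : 0 < (1 - Real.cos θ) / 2 := by rw [← h3]; positivity
  have h0 : cayleyLine θ ^ 2 = ((1 - Real.cos θ) / 2)⁻¹ - 1 := by
    rw [← h3, ← h1]; ring
  have h5 : ((circleMap 0 1 θ) ^ 2).re = 2 * Real.cos θ ^ 2 - 1 := by
    rw [sq, Complex.mul_re]
    simp [circleMap, Complex.exp_ofReal_mul_I_re, Complex.exp_ofReal_mul_I_im]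
    nlinarith [Real.sin_sq_add_cos_sq θ]
  rw [h1, h3, h0, h5]
  have h6 : 1 - Real.cos θ ≠ 0 := by intro h; rw [h] at h4; norm_num at h4
  field_simp
  ring

lemma circleAverage_re_pow {n : ℕ} (hn : n ≠ 0) :
    Real.circleAverage (fun w : ℂ => (w ^ n).re) 0 1 = 0 := by
  have h := circleAverage_mul_pow_eq_zero (f := fun _ => 1) diffContOnCl_const hn
  have h2 := ContinuousLinearMap.circleAverage_comp_comm (c := 0) (R := 1) reCLM
    (f := fun w : ℂ => (1:ℂ) * w ^ n) (ContinuousOn.circleIntegrable' (by fun_prop))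
  rw [h] at h2
  simpa [Function.comp_def] using h2

lemma circleAverage_mul_one_sub_re_pow (g : ℂ → ℝ) (hg : CircleIntegrable g 0 1) (n : ℕ) (d : ℝ) :
    Real.circleAverage (fun w => g w * ((1 - (w ^ n).re) / d)) 0 1
      = (Real.circleAverage g 0 1 - Real.circleAverage (fun w => g w * (w ^ n).re) 0 1) / d := by
  have hi : CircleIntegrable (fun w => g w * (w ^ n).re) 0 1 :=
    IntervalIntegrable.mul_continuousOn (f := fun θ => g (circleMap 0 1 θ)) hg
      (g := fun θ => (circleMap 0 1 θ ^ n).re) (by fun_prop)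
  have e : (fun w => g w * ((1 - (w ^ n).re) / d))
      = fun w => d⁻¹ • (g w - g w * (w ^ n).re) := by
    funext w; simp only [smul_eq_mul]; ring
  rw [e, Real.circleAverage_fun_smul, Real.circleAverage_fun_sub hg hi, smul_eq_mul]
  ring

lemma integral_kernel_log_norm_line {ρ : ℂ} (hρ : 1 / 2 ≤ ρ.re) :
    Integrable (fun t : ℝ => 1 / (1 + t ^ 2) ^ 2 * Real.log ‖(1 + I * t) / 2 - ρ‖) ∧
    ∫ t : ℝ, 1 / (1 + t ^ 2) ^ 2 * Real.log ‖(1 + I * t) / 2 - ρ‖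
      = π * (Real.log ‖ρ‖ / 2 - (ρ⁻¹).re / 4) := by
  have h := integral_log_norm_line hρ (k := fun t => 1 / (1 + t ^ 2) ^ 2)
    (K := fun w => (1 - (w ^ 1).re) / 4) (by fun_prop) fun θ hθ => by
      simpa using kernel_cayleyLine hθ
  refine ⟨h.1, h.2.trans ?_⟩
  have h1 := circleAverage_mul_one_sub_re_pow (fun _ => 1) (circleIntegrable_const _ _ _) 1 4
  simp only [one_mul] at h1
  have hv := norm_one_sub_inv_le_one hρ
  rw [h1, circleAverage_mul_one_sub_re_pow _ (circleIntegrable_log_norm_sub_const 1),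
    circleAverage_mul_one_sub_re_pow _ (circleIntegrable_log_norm_sub_const 1),
    circleAverage_log_norm_sub_eq_zero hv, circleAverage_log_norm_sub_eq_zero norm_one.le,
    Real.circleAverage_const, circleAverage_re_pow one_ne_zero]
  simp only [pow_one]
  rw [circleAverage_log_norm_sub_mul_re hv, circleAverage_log_norm_sub_mul_re norm_one.le]
  simp only [sub_re, one_re]
  ring

lemma integral_kernel_sq_log_norm_line {ρ : ℂ} (hρ : 1 / 2 ≤ ρ.re) :
    Integrable (fun t : ℝ => t ^ 2 / (1 + t ^ 2) ^ 3 * Real.log ‖(1 + I * t) / 2 - ρ‖) ∧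
    ∫ t : ℝ, t ^ 2 / (1 + t ^ 2) ^ 3 * Real.log ‖(1 + I * t) / 2 - ρ‖
      = π * (Real.log ‖ρ‖ / 8 + (-2 * (ρ⁻¹).re + (ρ⁻¹ ^ 2).re) / 32) := by
  have h := integral_log_norm_line hρ (k := fun t => t ^ 2 / (1 + t ^ 2) ^ 3)
    (K := fun w => (1 - (w ^ 2).re) / 16) (by fun_prop) fun θ hθ => kernel_sq_cayleyLine hθ
  refine ⟨h.1, h.2.trans ?_⟩
  have h1 := circleAverage_mul_one_sub_re_pow (fun _ => 1) (circleIntegrable_const _ _ _) 2 16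
  simp only [one_mul] at h1
  have hv := norm_one_sub_inv_le_one hρ
  rw [h1, circleAverage_mul_one_sub_re_pow _ (circleIntegrable_log_norm_sub_const 1),
    circleAverage_mul_one_sub_re_pow _ (circleIntegrable_log_norm_sub_const 1),
    circleAverage_log_norm_sub_eq_zero hv, circleAverage_log_norm_sub_eq_zero norm_one.le,
    Real.circleAverage_const, circleAverage_re_pow two_ne_zero,
    circleAverage_log_norm_sub_mul_re_sq hv, circleAverage_log_norm_sub_mul_re_sq norm_one.le]
  have e : (1 - ρ⁻¹) ^ 2 = 1 - 2 * ρ⁻¹ + ρ⁻¹ ^ 2 := by ring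
  rw [e]
  simp only [sub_re, add_re, one_re, one_pow, mul_re, re_ofNat, im_ofNat, zero_mul, sub_zero]
  ring

end LineIntegrals

/-! ### Complex absolutely continuous functions and the spaces H¹_loc, H¹_c. -/

namespace AbsolutelyContinuousOnInterval

variable {f g : ℝ → ℂ} {a b : ℝ}

lemma complex_mul (hf : AbsolutelyContinuousOnInterval f a b)
    (hg : AbsolutelyContinuousOnInterval g a b) :
    AbsolutelyContinuousOnInterval (fun x => f x * g x) a b := hf.smul hg

lemma lipschitz_comp {X Y : Type*} [PseudoMetricSpace X] [PseudoMetricSpace Y] {u : ℝ → X}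
    {φ : X → Y} (hφ : LipschitzWith 1 φ)
    (hu : AbsolutelyContinuousOnInterval u a b) :
    AbsolutelyContinuousOnInterval (fun x => φ (u x)) a b := by
  refine squeeze_zero (fun t => Finset.sum_nonneg fun i _ => dist_nonneg) (fun t => ?_) hu
  exact Finset.sum_le_sum fun i _ => by simpa using hφ.dist_le_mul _ _

lemma complex_re (hf : AbsolutelyContinuousOnInterval f a b) :
    AbsolutelyContinuousOnInterval (fun x => (f x).re) a b :=
  hf.lipschitz_comp (LipschitzWith.of_dist_le_mul fun x y => by
    simpa [dist_eq_norm] using Complex.abs_re_le_norm (x - y))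

lemma complex_im (hf : AbsolutelyContinuousOnInterval f a b) :
    AbsolutelyContinuousOnInterval (fun x => (f x).im) a b :=
  hf.lipschitz_comp (LipschitzWith.of_dist_le_mul fun x y => by
    simpa [dist_eq_norm] using Complex.abs_im_le_norm (x - y))

lemma complex_ae_differentiableAt (hf : AbsolutelyContinuousOnInterval f a b) :
    ∀ᵐ x : ℝ, x ∈ uIcc a b → DifferentiableAt ℝ f x :=
  hf.boundedVariationOn.ae_differentiableAt_of_mem_uIcc

lemma complex_ae_deriv_re (hf : AbsolutelyContinuousOnInterval f a b) :
    ∀ᵐ x : ℝ, x ∈ uIoc a b → deriv (fun y => (f y).re) x = (deriv f x).re := by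
  filter_upwards [hf.complex_ae_differentiableAt] with x hx hm
  exact (Complex.reCLM.hasFDerivAt.comp_hasDerivAt x
    (hx (uIoc_subset_uIcc hm)).hasDerivAt).deriv

lemma complex_ae_deriv_im (hf : AbsolutelyContinuousOnInterval f a b) :
    ∀ᵐ x : ℝ, x ∈ uIoc a b → deriv (fun y => (f y).im) x = (deriv f x).im := by
  filter_upwards [hf.complex_ae_differentiableAt] with x hx hm
  exact (Complex.imCLM.hasFDerivAt.comp_hasDerivAt x
    (hx (uIoc_subset_uIcc hm)).hasDerivAt).deriv

lemma complex_intervalIntegrable_deriv (hf : AbsolutelyContinuousOnInterval f a b) :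
    IntervalIntegrable (deriv f) volume a b := by
  have h1 : IntervalIntegrable (fun x => (((deriv f x).re : ℝ) : ℂ)) volume a b :=
    by
    have := hf.complex_re.intervalIntegrable_deriv.congr_ae
      ((ae_restrict_iff' measurableSet_uIoc).2 hf.complex_ae_deriv_re)
    exact ⟨this.1.ofReal, this.2.ofReal⟩
  have h2 : IntervalIntegrable (fun x => (((deriv f x).im : ℝ) : ℂ)) volume a b :=
    by
    have := hf.complex_im.intervalIntegrable_deriv.congr_ae
      ((ae_restrict_iff' measurableSet_uIoc).2 hf.complex_ae_deriv_im)
    exact ⟨this.1.ofReal, this.2.ofReal⟩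
  have := h1.add (h2.mul_const Complex.I)
  simpa only [Complex.re_add_im] using! this

/-- The real and imaginary parts are absolutely continuous, and their derivatives agree almost
everywhere with those of the complex derivative, so the real theorem applies twice. -/
lemma complex_integral_deriv_eq_sub (hf : AbsolutelyContinuousOnInterval f a b) :
    ∫ x in a..b, deriv f x = f b - f a := by
  have hi := hf.complex_intervalIntegrable_deriv
  apply Complex.ext
  · have h1 := Complex.reCLM.intervalIntegral_comp_comm hi
    simp only [Complex.reCLM_apply] at h1
    rw [← h1, Complex.sub_re, ← hf.complex_re.integral_deriv_eq_sub]
    refine intervalIntegral.integral_congr_ae ?_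
    filter_upwards [hf.complex_ae_deriv_re] with x hx hm using (hx hm).symm
  · have h1 := Complex.imCLM.intervalIntegral_comp_comm hi
    simp only [Complex.imCLM_apply] at h1
    rw [← h1, Complex.sub_im, ← hf.complex_im.integral_deriv_eq_sub]
    refine intervalIntegral.integral_congr_ae ?_
    filter_upwards [hf.complex_ae_deriv_im] with x hx hm using (hx hm).symm

lemma complex_ae_deriv_mul (hf : AbsolutelyContinuousOnInterval f a b)
    (hg : AbsolutelyContinuousOnInterval g a b) :
    ∀ᵐ x : ℝ, x ∈ uIcc a b →
      deriv (fun y => f y * g y) x = deriv f x * g x + f x * deriv g x := by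
  filter_upwards [hf.complex_ae_differentiableAt, hg.complex_ae_differentiableAt] with x h1 h2 hm
  exact ((h1 hm).hasDerivAt.mul (h2 hm).hasDerivAt).deriv

end AbsolutelyContinuousOnInterval

lemma MemH1loc.mul {f g : ℝ → ℂ} (hf : MemH1loc f) (hg : MemH1loc g) :
    MemH1loc fun x => f x * g x := by
  intro b hb
  obtain ⟨hf1, hf2⟩ := hf b hb
  obtain ⟨hg1, hg2⟩ := hg b hb
  refine ⟨hf1.complex_mul hg1, ?_⟩
  have key : ∀ {u v : ℝ → ℂ}, AbsolutelyContinuousOnInterval u 0 b →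
      MemLp v 2 (volume.restrict (Icc 0 b)) →
      MemLp (fun x => u x * v x) 2 (volume.restrict (Icc 0 b)) := by
    intro u v hu hv
    obtain ⟨C, hC⟩ := hu.exists_bound
    rw [uIcc_of_le hb] at hC
    have hum : AEStronglyMeasurable u (volume.restrict (Icc 0 b)) := by
      have := hu.continuousOn
      rw [uIcc_of_le hb] at this
      exact this.aestronglyMeasurable measurableSet_Icc
    refine MemLp.of_le_mul (c := C) hv (hum.mul hv.1) ?_
    filter_upwards [ae_restrict_mem measurableSet_Icc] with x hx
    rw [norm_mul]
    gcongr
    exact hC x hx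
  have h1 := (key hg1 hf2).add (key hf1 hg2)
  refine h1.ae_eq ?_
  filter_upwards [ae_restrict_mem measurableSet_Icc,
    ae_restrict_of_ae (hf1.complex_ae_deriv_mul hg1)] with x hx h
  rw [h (by rwa [uIcc_of_le hb])]
  simp only [Pi.add_apply]
  ring

lemma deriv_eq_zero_of_eq_zero_on_Ici {h : ℝ → ℂ} {b x : ℝ} (hb : ∀ y, b ≤ y → h y = 0)
    (hx : b < x) : deriv h x = 0 := by
  have : h =ᶠ[nhds x] fun _ => 0 := by
    filter_upwards [Ioi_mem_nhds hx] with y hy using hb y (le_of_lt hy)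
  rw [this.deriv_eq, deriv_const]

lemma integrableOn_Ioi_of_Icc {F : ℝ → ℂ} {b : ℝ} (hF : IntegrableOn F (Icc 0 b))
    (h0 : ∀ x, b < x → F x = 0) : IntegrableOn F (Ioi 0) := by
  have h2 : IntegrableOn F (Ioi b) :=
    (integrableOn_congr_fun (fun x hx => h0 x hx) measurableSet_Ioi).2 integrableOn_zero
  refine (hF.union h2).mono_set fun x hx => ?_
  rcases le_or_gt x b with h | h
  · exact Or.inl ⟨le_of_lt hx, h⟩
  · exact Or.inr h

lemma MemH1c.mul_left {f h : ℝ → ℂ} (hf : MemH1loc f) (hh : MemH1c h) :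
    MemH1c fun x => f x * h x :=
  ⟨hf.mul hh.1, hh.2.imp fun b hb x hx => by simp [hb x hx]⟩

lemma MemH1c.exists_nonneg {h : ℝ → ℂ} (hh : MemH1c h) :
    ∃ b : ℝ, 0 ≤ b ∧ ∀ x, b ≤ x → h x = 0 := by
  obtain ⟨b, hb⟩ := hh.2
  exact ⟨max b 0, le_max_right _ _, fun x hx => hb x ((le_max_left _ _).trans hx)⟩

lemma MemH1loc.integrableOn_deriv_mul_deriv {f h : ℝ → ℂ} (hf : MemH1loc f) (hh : MemH1loc h)
    {b : ℝ} (hb : 0 ≤ b) : IntegrableOn (fun x => deriv f x * deriv h x) (Icc 0 b) :=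
  MemLp.integrable_mul (hf b hb).2 (hh b hb).2

lemma MemH1loc.integrableOn_w_mul_deriv (S : HalfLineString) {h : ℝ → ℂ} (hh : MemH1loc h)
    {b : ℝ} (hb : 0 ≤ b) : IntegrableOn (fun x => (S.w x : ℂ) * deriv h x) (Icc 0 b) :=
  MemLp.integrable_mul (S.memLp_w b).ofReal (hh b hb).2

lemma MemH1c.integrableOn_deriv_mul_deriv {f h : ℝ → ℂ} (hf : MemH1loc f) (hh : MemH1c h) :
    IntegrableOn (fun x => deriv f x * deriv h x) (Ioi 0) := by
  obtain ⟨b, hb0, hb⟩ := hh.exists_nonneg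
  exact integrableOn_Ioi_of_Icc (hf.integrableOn_deriv_mul_deriv hh.1 hb0) fun x hx => by
    rw [deriv_eq_zero_of_eq_zero_on_Ici hb hx, mul_zero]

lemma MemH1c.integrableOn_w_mul_deriv (S : HalfLineString) {h : ℝ → ℂ} (hh : MemH1c h) :
    IntegrableOn (fun x => (S.w x : ℂ) * deriv h x) (Ioi 0) := by
  obtain ⟨b, hb0, hb⟩ := hh.exists_nonneg
  exact integrableOn_Ioi_of_Icc (hh.1.integrableOn_w_mul_deriv S hb0) fun x hx => by
    rw [deriv_eq_zero_of_eq_zero_on_Ici hb hx, mul_zero]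

lemma MemH1loc.absolutelyContinuousOnInterval {f : ℝ → ℂ} (hf : MemH1loc f) {p q : ℝ}
    (hp : 0 ≤ p) (hq : 0 ≤ q) : AbsolutelyContinuousOnInterval f p q := by
  refine (hf (max p q) (hp.trans (le_max_left _ _))).1.mono ?_
  rw [uIcc_of_le (hp.trans (le_max_left _ _))]
  exact uIcc_subset_Icc ⟨hp, le_max_left _ _⟩ ⟨hq, le_max_right _ _⟩

/-- A function that is Lipschitz on every `[0, b]` is in `H¹_loc`. -/
lemma MemH1loc.of_lipschitzOnWith {f : ℝ → ℂ}
    (hf : ∀ b : ℝ, 0 ≤ b → ∃ K, LipschitzOnWith K f (Icc 0 b)) : MemH1loc f := by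
  intro b hb
  obtain ⟨K, hK⟩ := hf b hb
  refine ⟨LipschitzOnWith.absolutelyContinuousOnInterval (K := K) (by rwa [uIcc_of_le hb]), ?_⟩
  refine MemLp.of_bound (measurable_deriv f).aestronglyMeasurable (K : ℝ) ?_
  rw [← restrict_Ioo_eq_restrict_Icc]
  filter_upwards [ae_restrict_mem measurableSet_Ioo] with x hx
  exact norm_deriv_le_of_lipschitzOn (Icc_mem_nhds hx.1 hx.2) hK

/-! ### Nodes of a string of class 𝓕_α. -/

/-- A decomposition of `[0, R]` by the points `s 0 ≤ s 1 ≤ … ≤ s n` such that `w` is equal to the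
constant `c i` on `(s i, s (i + 1))` and `υ` is the sum of the point masses `m i` at `s i`. -/
structure PieceData (S : HalfLineString) (R : ℝ) where
  n : ℕ
  s : ℕ → ℝ
  c : ℕ → ℝ
  m : ℕ → ℝ
  mono : Monotone s
  s_zero : s 0 = 0
  s_n : s n = R
  w_eq : ∀ i < n, ∀ᵐ x ∂volume.restrict (Ioo (s i) (s (i + 1))), S.w x = c i
  m_nonneg : ∀ i, 0 ≤ m i
  υ_eq : S.υ.restrict (Ici 0) =
    ∑ i ∈ Finset.range n, ENNReal.ofReal (m i) • Measure.dirac (s i)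

lemma measure_eq_sum_dirac {X : Type*} [MeasurableSpace X] [MeasurableSingletonClass X]
    {μ : Measure X} {T : Finset X} (hT : μ (T : Set X)ᶜ = 0) :
    μ = ∑ x ∈ T, μ {x} • Measure.dirac x := by
  classical
  ext A hA
  have h1 : μ A = μ (A ∩ T) := by
    refine le_antisymm ?_ (measure_mono inter_subset_left)
    rw [← measure_inter_add_sdiff A T.measurableSet]
    have : μ (A \ T) = 0 := measure_mono_null (fun x hx => hx.2) hT
    rw [this, add_zero]
  have h2 : A ∩ (T : Set X) = ((T.filter (· ∈ A) : Finset X) : Set X) := by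
    ext x; simp [and_comm]
  rw [h1, h2, ← sum_measure_singleton, Finset.sum_filter, Measure.finsetSum_apply]
  refine Finset.sum_congr rfl fun x _ => ?_
  rw [Measure.smul_apply, Measure.dirac_apply' _ hA, Set.indicator_apply]
  split_ifs <;> simp

/-- The increasing enumeration of a nonempty finite set of reals, continued by its maximum. -/
noncomputable def Finset.enumReal (T : Finset ℝ) (n : ℕ) (hn : T.card = n + 1) (i : ℕ) : ℝ :=
  T.orderEmbOfFin hn ⟨min i n, by omega⟩

lemma Finset.enumReal_mono {T : Finset ℝ} {n : ℕ} (hn : T.card = n + 1) :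
    Monotone (T.enumReal n hn) := by
  intro i j hij
  refine (T.orderEmbOfFin hn).monotone ?_
  simp only [Fin.mk_le_mk]
  omega

lemma Finset.exists_enumReal_eq {T : Finset ℝ} {n : ℕ} (hn : T.card = n + 1) {x : ℝ} (hx : x ∈ T) :
    ∃ i ≤ n, T.enumReal n hn i = x := by
  have : x ∈ Set.range (T.orderEmbOfFin hn) := by rw [Finset.range_orderEmbOfFin]; exact hx
  obtain ⟨i, hi⟩ := this
  refine ⟨i, by omega, ?_⟩
  rw [← hi, Finset.enumReal]
  congr 1
  ext
  simp only
  omega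

lemma Finset.enumReal_lt {T : Finset ℝ} {n : ℕ} (hn : T.card = n + 1) {i j : ℕ} (hij : i < j)
    (hj : j ≤ n) : T.enumReal n hn i < T.enumReal n hn j := by
  refine (T.orderEmbOfFin hn).strictMono ?_
  simp only [Fin.mk_lt_mk]
  omega

lemma Finset.enumReal_mem {T : Finset ℝ} {n : ℕ} (hn : T.card = n + 1) (i : ℕ) :
    T.enumReal n hn i ∈ T := T.orderEmbOfFin_mem hn _

lemma Finset.enumReal_succ_le {T : Finset ℝ} {n : ℕ} (hn : T.card = n + 1) {i : ℕ} {x : ℝ}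
    (hx : x ∈ T) (h : T.enumReal n hn i < x) : T.enumReal n hn (i + 1) ≤ x := by
  obtain ⟨j, hj, rfl⟩ := Finset.exists_enumReal_eq hn hx
  refine Finset.enumReal_mono hn ?_
  by_contra! hlt
  exact absurd (Finset.enumReal_mono hn (show j ≤ i by omega)) (not_le.2 h)

/-- The nodes are the breakpoints of `w` together with the support points of `υ` in [0, R), in
strictly increasing order. Strictness prevents a point mass from being counted at two indices. -/
lemma HalfLineString.MemClassF.nonempty_pieceData {S : HalfLineString} {α R : ℝ}
    (hS : S.MemClassF α R) : Nonempty (PieceData S R) := by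
  classical
  obtain ⟨m, t, c, ht, ht0, htm, hc⟩ := hS.piecewiseConst
  have hR := hS.R_pos
  set U : Finset ℝ := hS.support_finite.toFinset.filter (fun x => 0 ≤ x ∧ x < R) with hU
  set T : Finset ℝ := (Finset.range (m + 1)).image t ∪ U with hTdef
  have htT : ∀ j ≤ m, t j ∈ T := fun j hj =>
    Finset.mem_union_left _ (Finset.mem_image_of_mem t (Finset.mem_range.2 (by omega)))
  have h0T : (0:ℝ) ∈ T := by rw [← ht0]; exact htT 0 (by omega)
  have hRT : R ∈ T := by rw [← htm]; exact htT m le_rfl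
  have hTb : ∀ x ∈ T, 0 ≤ x ∧ x ≤ R := by
    intro x hx
    rcases Finset.mem_union.1 hx with h | h
    · obtain ⟨j, hj, rfl⟩ := Finset.mem_image.1 h
      rw [← ht0, ← htm]
      exact ⟨ht (by omega), ht (by have := Finset.mem_range.1 hj; omega)⟩
    · have := (Finset.mem_filter.1 h).2
      exact ⟨this.1, this.2.le⟩
  obtain ⟨n, hn⟩ : ∃ n, T.card = n + 1 :=
    ⟨T.card - 1, by have := Finset.card_pos.2 ⟨0, h0T⟩; omega⟩
  set s := T.enumReal n hn with hs
  have hs0 : s 0 = 0 := by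
    obtain ⟨i, hi, h⟩ := Finset.exists_enumReal_eq hn h0T
    have h1 := Finset.enumReal_mono hn (Nat.zero_le i)
    exact le_antisymm (h1.trans h.le) (hTb _ (Finset.enumReal_mem hn 0)).1
  have hsn : s n = R := by
    obtain ⟨i, hi, h⟩ := Finset.exists_enumReal_eq hn hRT
    have h1 := Finset.enumReal_mono hn hi
    exact le_antisymm (hTb _ (Finset.enumReal_mem hn n)).2 (h.ge.trans h1)
  have hw : ∀ i < n, ∃ d : ℝ, ∀ᵐ x ∂volume.restrict (Ioo (s i) (s (i + 1))), S.w x = d := by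
    intro i hi
    -- The first breakpoint t j beyond s i: then t (j - 1) ≤ s i and s (i + 1) ≤ t j, so the new
    -- piece lies inside one old piece.
    have hex : ∃ j, s i < t j := ⟨m, by rw [htm, ← hsn]; exact Finset.enumReal_lt hn hi le_rfl⟩
    have hlt := Nat.find_spec hex
    have hmin : ∀ j < Nat.find hex, t j ≤ s i := fun j hj => not_lt.1 (Nat.find_min hex hj)
    have hle : Nat.find hex ≤ m := Nat.find_min' hex (by
      rw [htm, ← hsn]; exact Finset.enumReal_lt hn hi le_rfl)
    have hpos : Nat.find hex ≠ 0 := by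
      intro h
      rw [h, ht0] at hlt
      exact absurd (hTb _ (Finset.enumReal_mem hn i)).1 (not_le.2 hlt)
    obtain ⟨j, hj⟩ := Nat.exists_eq_succ_of_ne_zero hpos
    rw [hj] at hlt hmin hle
    refine ⟨c j, ae_restrict_of_ae_restrict_of_subset ?_ (hc j (by omega))⟩
    exact Ioo_subset_Ioo (hmin j (by omega)) (Finset.enumReal_succ_le hn (htT _ hle) hlt)
  choose! d hd using hw
  refine ⟨⟨n, s, d, fun i => S.υ.real {s i}, Finset.enumReal_mono hn, hs0, hsn, hd,
    fun i => measureReal_nonneg, ?_⟩⟩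
  have := S.locallyFinite
  have hnull : S.υ.restrict (Ici 0) ((((Finset.range n).image s : Finset ℝ) : Set ℝ)ᶜ) = 0 := by
    rw [Measure.restrict_apply (Finset.measurableSet _).compl]
    refine measure_mono_null (t := S.υ.supportᶜ ∪ Ici R) ?_
      (measure_union_null Measure.measure_compl_support hS.υ_eq)
    rintro x ⟨hx1, hx2⟩
    by_contra hcon
    simp only [mem_union, mem_compl_iff, mem_Ici, not_or, not_not, not_le] at hcon
    apply hx1
    have hxT : x ∈ T := Finset.mem_union_right _ (Finset.mem_filter.2
      ⟨hS.support_finite.mem_toFinset.2 hcon.1, hx2, hcon.2⟩)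
    obtain ⟨i, hi, h⟩ := Finset.exists_enumReal_eq hn hxT
    rw [Finset.mem_coe, Finset.mem_image]
    -- The index n is excluded because s n = R, while x < R.
    refine ⟨i, Finset.mem_range.2 (lt_of_le_of_ne hi ?_), h⟩
    rintro rfl
    rw [← h] at hcon
    exact hcon.2.ne hsn
  have h1 := measure_eq_sum_dirac hnull
  rw [h1, Finset.sum_image]
  · refine Finset.sum_congr rfl fun i _ => ?_
    rw [Measure.restrict_apply (measurableSet_singleton _), measureReal_def,
      ENNReal.ofReal_toReal]
    · congr 2
      ext x
      simp only [mem_inter_iff, mem_singleton_iff, mem_Ici, and_iff_left_iff_imp]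
      rintro rfl
      exact (hTb _ (Finset.enumReal_mem hn i)).1
    · exact (isCompact_singleton.measure_lt_top).ne
  · intro i hi j hj hij
    simp only [Finset.coe_range, mem_Iio] at hi hj
    rcases lt_trichotomy i j with h | h | h
    · exact absurd hij (Finset.enumReal_lt hn h hj.le).ne
    · exact h
    · exact absurd hij (Finset.enumReal_lt hn h hi.le).ne'

namespace PieceData

variable {S : HalfLineString} {R : ℝ} (D : PieceData S R)

lemma integrableOn_υ (D : PieceData S R) {E : Type*} [NormedAddCommGroup E] (F : ℝ → E) :
    IntegrableOn F (Ici 0) S.υ := by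
  rw [IntegrableOn, D.υ_eq, integrable_finsetSum_measure]
  intro i _
  exact (integrable_dirac (by simp)).smul_measure ENNReal.ofReal_ne_top

lemma integral_υ {E : Type*} [NormedAddCommGroup E] [NormedSpace ℝ E] [CompleteSpace E]
    (F : ℝ → E) :
    ∫ x in Ici 0, F x ∂S.υ = ∑ i ∈ Finset.range D.n, D.m i • F (D.s i) := by
  rw [D.υ_eq, integral_finsetSum_measure]
  · refine Finset.sum_congr rfl fun i _ => ?_
    rw [integral_smul_measure, integral_dirac, ENNReal.toReal_ofReal (D.m_nonneg i)]
  · intro i _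
    exact (integrable_dirac (by simp)).smul_measure ENNReal.ofReal_ne_top

lemma s_nonneg (i : ℕ) : 0 ≤ D.s i := by
  rw [← D.s_zero]; exact D.mono (Nat.zero_le i)

lemma s_le {i : ℕ} (hi : i ≤ D.n) : D.s i ≤ R := by
  exact (D.mono hi).trans D.s_n.le

lemma s_le_succ (i : ℕ) : D.s i ≤ D.s (i + 1) := D.mono (Nat.le_succ i)

end PieceData

/-! ### Piecewise affine solutions on [0, R]. -/

namespace PieceData

variable {S : HalfLineString} {R : ℝ} (D : PieceData S R)

/-- The slope of a solution on `(s i, s (i + 1))` in terms of its value `f` and its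
quasi-derivative `g` at `s (i + 1)`. -/
def slope (z : ℂ) (f g : ℕ → ℂ) (i : ℕ) : ℂ := g (i + 1) - z * D.c i * f (i + 1)

/-- `f i` and `g i` are the values of a solution and its (left) quasi-derivative at `s i`. -/
def IsNodal (z : ℂ) (f g : ℕ → ℂ) : Prop :=
  ∀ i < D.n, f i = f (i + 1) - (D.s (i + 1) - D.s i : ℝ) * D.slope z f g i ∧
    g i = D.slope z f g i + z * D.c i * f i + z ^ 2 * D.m i * f i

/-- The transfer relations, solved forwards with prescribed data at 0. -/
lemma exists_isNodal (z f₀ g₀ : ℂ) : ∃ f g : ℕ → ℂ, D.IsNodal z f g ∧ f 0 = f₀ ∧ g 0 = g₀ := by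
  let step : ℕ → ℂ × ℂ → ℂ × ℂ := fun i p =>
    let B := p.2 - z ^ 2 * D.m i * p.1 - z * D.c i * p.1
    let f' := p.1 + (D.s (i + 1) - D.s i : ℝ) * B
    (f', B + z * D.c i * f')
  let u : ℕ → ℂ × ℂ := fun i => Nat.rec (f₀, g₀) step i
  have hu : ∀ i, u (i + 1) = step i (u i) := fun i => rfl
  refine ⟨fun i => (u i).1, fun i => (u i).2, fun i _ => ?_, rfl, rfl⟩
  simp only [slope, hu, step]
  constructor <;> ring

lemma integral_deriv_mul_piece {f h w : ℝ → ℂ} {p q : ℝ} {c A B : ℂ} (hpq : p ≤ q)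
    (hf : ∀ x ∈ Icc p q, f x = A + (x - q) * B) (hw : ∀ᵐ x ∂volume.restrict (Ioo p q), w x = c)
    (hfac : AbsolutelyContinuousOnInterval f p q) (hh : AbsolutelyContinuousOnInterval h p q) :
    ∫ x in p..q, deriv f x * deriv h x = B * (h q - h p) ∧
    ∫ x in p..q, w x * deriv (fun y => f y * h y) x = c * (f q * h q - f p * h p) := by
  constructor
  · rw [← hh.complex_integral_deriv_eq_sub, ← intervalIntegral.integral_const_mul,
      intervalIntegral.integral_of_le hpq, intervalIntegral.integral_of_le hpq,
      integral_Ioc_eq_integral_Ioo, integral_Ioc_eq_integral_Ioo]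
    refine setIntegral_congr_fun measurableSet_Ioo fun x hx => ?_
    have h1 : f =ᶠ[nhds x] fun y : ℝ => A + ((y : ℂ) - q) * B := by
      filter_upwards [Icc_mem_nhds hx.1 hx.2] with y hy using hf y hy
    have h2 : HasDerivAt (fun y : ℝ => A + ((y : ℂ) - q) * B) (1 * B) x :=
      (((hasDerivAt_id x).ofReal_comp.sub_const _).mul_const B).const_add A
    rw [h1.deriv_eq, h2.deriv, one_mul]
  · rw [← (hfac.complex_mul hh).complex_integral_deriv_eq_sub,
      ← intervalIntegral.integral_const_mul,
      intervalIntegral.integral_of_le hpq, intervalIntegral.integral_of_le hpq,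
      integral_Ioc_eq_integral_Ioo, integral_Ioc_eq_integral_Ioo]
    refine integral_congr_ae ?_
    filter_upwards [hw] with x hx
    rw [hx]

variable {D}

lemma sum_integral_pieces {E : Type*} [NormedAddCommGroup E] [NormedSpace ℝ E] {F : ℝ → E}
    (hF : IntegrableOn F (Icc 0 R)) :
    ∑ i ∈ Finset.range D.n, ∫ x in D.s i..D.s (i + 1), F x = ∫ x in (0:ℝ)..R, F x := by
  have h := intervalIntegral.sum_integral_adjacent_intervals (f := F) (a := D.s) (n := D.n)
    (μ := volume) fun i hi => by
      rw [intervalIntegrable_iff_integrableOn_Icc_of_le (D.s_le_succ i)]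
      exact hF.mono_set (Icc_subset_Icc (D.s_nonneg i) (D.s_le hi))
  rwa [D.s_zero, D.s_n] at h

/-- On each piece both integrands on the left integrate exactly to increments, because φ' and `w`
are constant there. Summing by parts, the quasi-derivative is continuous except for jumps at the
nodes, and these jumps add up to the integral against `υ`. The test function need not vanish at R,
whence the boundary term. -/
lemma IsNodal.weak_identity (hR : 0 ≤ R) {z : ℂ} {f g : ℕ → ℂ} (hN : D.IsNodal z f g) {φ h : ℝ → ℂ}
    (hφ : ∀ i < D.n, ∀ x ∈ Icc (D.s i) (D.s (i + 1)),
      φ x = f (i + 1) + (x - D.s (i + 1)) * D.slope z f g i)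
    (hφ1 : MemH1loc φ) (hh : MemH1loc h) :
    (∫ x in (0:ℝ)..R, deriv φ x * deriv h x)
      + z * (∫ x in (0:ℝ)..R, (S.w x : ℂ) * deriv (fun y => φ y * h y) x)
    = g D.n * h R - g 0 * h 0 + z ^ 2 * ∫ x in Ici 0, φ x * h x ∂S.υ := by
  have hs : ∀ i < D.n, φ (D.s i) = f i := by
    intro i hi
    rw [hφ i hi _ ⟨le_rfl, D.s_le_succ i⟩, (hN i hi).1]
    push_cast; ring
  have hs' : ∀ i < D.n, φ (D.s (i + 1)) = f (i + 1) := by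
    intro i hi
    rw [hφ i hi _ ⟨D.s_le_succ i, le_rfl⟩]
    ring
  rw [← sum_integral_pieces (D := D) (hφ1.integrableOn_deriv_mul_deriv hh hR),
    ← sum_integral_pieces (D := D) ((hφ1.mul hh).integrableOn_w_mul_deriv S hR),
    D.integral_υ, Finset.mul_sum, Finset.mul_sum, ← Finset.sum_add_distrib]
  have htel := Finset.sum_range_sub (fun i => g i * h (D.s i)) D.n
  rw [D.s_n, D.s_zero] at htel
  rw [← htel, ← Finset.sum_add_distrib]
  refine Finset.sum_congr rfl fun i hi => ?_
  have hi' := Finset.mem_range.1 hi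
  have hp := integral_deriv_mul_piece (w := fun x => (S.w x : ℂ)) (c := D.c i) (D.s_le_succ i)
    (hφ i hi') (by filter_upwards [D.w_eq i hi'] with x hx using by rw [hx])
    (hφ1.absolutelyContinuousOnInterval (D.s_nonneg i) (D.s_nonneg _))
    (hh.absolutelyContinuousOnInterval (D.s_nonneg i) (D.s_nonneg _))
  rw [hp.1, hp.2, hs i hi', hs' i hi', Complex.real_smul, (hN i hi').2]
  have : g (i + 1) = D.slope z f g i + z * D.c i * f (i + 1) := by rw [slope]; ring
  rw [this]
  ring

variable (D)

/-- The piecewise affine function on `[0, R]` with slopes `B i`, continued by `Φ` on `[R, ∞)`. -/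
noncomputable def glue (B : ℕ → ℂ) (Φ : ℝ → ℂ) (x : ℝ) : ℂ :=
  Φ (max x R) - ∑ i ∈ Finset.range D.n, (max x (D.s (i + 1)) - max x (D.s i) : ℝ) * B i

variable {D}

lemma glue_of_le {B : ℕ → ℂ} {Φ : ℝ → ℂ} {x : ℝ} (hx : R ≤ x) : D.glue B Φ x = Φ x := by
  rw [glue, max_eq_left hx, Finset.sum_eq_zero, sub_zero]
  intro i hi
  have := D.s_le (Finset.mem_range.1 hi)
  rw [max_eq_left ((D.s_le (Finset.mem_range.1 hi)).trans hx),
    max_eq_left ((D.s_le (Finset.mem_range.1 hi).le).trans hx)]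
  simp

lemma IsNodal.glue_eq {z : ℂ} {f g : ℕ → ℂ} (hN : D.IsNodal z f g) {Φ : ℝ → ℂ}
    (hΦ : Φ R = f D.n) {j : ℕ} (hj : j < D.n) {x : ℝ} (hx : x ∈ Icc (D.s j) (D.s (j + 1))) :
    D.glue (D.slope z f g) Φ x = f (j + 1) + (x - D.s (j + 1)) * D.slope z f g j := by
  -- The coefficient of B i is the length of the part of [s i, s (i + 1)] to the right of x. Pieces
  -- before j contribute nothing, piece j contributes its part beyond x, and later pieces contribute
  -- full increments of f, which telescope.
  have key : ∀ k, j + 1 + k ≤ D.n → ∑ i ∈ Finset.range (j + 1 + k),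
      (max x (D.s (i + 1)) - max x (D.s i) : ℝ) * D.slope z f g i
        = f (j + 1 + k) - f (j + 1) + (D.s (j + 1) - x : ℝ) * D.slope z f g j := by
    intro k
    induction k with
    | zero =>
      intro _
      rw [add_zero, Finset.sum_range_succ, Finset.sum_eq_zero, max_eq_right hx.2, max_eq_left hx.1]
      · simp
      · intro i hi
        have hi' := Finset.mem_range.1 hi
        rw [max_eq_left ((D.mono hi').trans hx.1), max_eq_left ((D.mono hi'.le).trans hx.1)]
        simp
    | succ k ih =>
      intro hk
      have h1 : x ≤ D.s (j + 1 + k) := hx.2.trans (D.mono (by omega))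
      rw [← add_assoc, Finset.sum_range_succ, ih (by omega), max_eq_right h1,
        max_eq_right (h1.trans (D.s_le_succ _))]
      have := (hN (j + 1 + k) (by omega)).1
      linear_combination this
  obtain ⟨k, hk⟩ := Nat.exists_eq_add_of_le hj
  have := key k (by omega)
  rw [← Nat.succ_eq_add_one, ← hk] at this
  rw [glue, max_eq_right (hx.2.trans (D.s_le hj)), this, hΦ]
  push_cast; ring

lemma IsNodal.glue_zero {z : ℂ} {f g : ℕ → ℂ} (hR : 0 < R) (hN : D.IsNodal z f g) {Φ : ℝ → ℂ}
    (hΦ : Φ R = f D.n) : D.glue (D.slope z f g) Φ 0 = f 0 := by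
  have hn : 0 < D.n := by
    rcases Nat.eq_zero_or_pos D.n with h | h
    · have h1 := D.s_n
      rw [h, D.s_zero] at h1
      exact absurd h1 hR.ne
    · exact h
  have := hN.glue_eq hΦ hn (x := 0) ⟨D.s_zero.le, D.s_nonneg 1⟩
  rw [this, (hN 0 hn).1, D.s_zero]
  push_cast; ring

lemma memH1loc_glue (B : ℕ → ℂ) {Φ : ℝ → ℂ}
    (hΦ : ∀ b, ∃ K, LipschitzOnWith K Φ (Icc R b)) : MemH1loc (D.glue B Φ) := by
  refine MemH1loc.of_lipschitzOnWith fun b _ => ?_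
  have hmax : ∀ a : ℝ, LipschitzWith 1 fun x : ℝ => max x a := fun a =>
    LipschitzWith.id.max_const a
  have h1 : ∃ K, LipschitzOnWith K (fun x => Φ (max x R)) (Icc 0 b) := by
    obtain ⟨K, hK⟩ := hΦ (max b R)
    exact ⟨K * 1, hK.comp (hmax R).lipschitzOnWith fun x hx =>
      ⟨le_max_right _ _, max_le_max_right _ hx.2⟩⟩
  have h2 : ∀ n : ℕ, ∃ K, LipschitzWith K fun x => ∑ i ∈ Finset.range n,
      (max x (D.s (i + 1)) - max x (D.s i) : ℝ) * B i := by
    intro n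
    induction n with
    | zero => exact ⟨0, by simp⟩
    | succ n ih =>
      obtain ⟨K, hK⟩ := ih
      have h3 : LipschitzWith (2 * ‖B n‖₊)
          fun x => ((max x (D.s (n + 1)) - max x (D.s n) : ℝ) : ℂ) * B n := by
        refine LipschitzWith.of_dist_le_mul fun x y => ?_
        rw [dist_eq_norm, ← sub_mul, ← Complex.ofReal_sub, norm_mul, Complex.norm_real]
        have e1 := (hmax (D.s (n + 1))).dist_le_mul x y
        have e2 := (hmax (D.s n)).dist_le_mul x y
        simp only [NNReal.coe_one, one_mul, Real.dist_eq] at e1 e2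
        rw [Real.norm_eq_abs]
        push_cast
        rw [Real.dist_eq]
        have e3 : |max x (D.s (n + 1)) - max x (D.s n) - (max y (D.s (n + 1)) - max y (D.s n))|
            ≤ 2 * |x - y| := by
          rw [abs_le] at *
          constructor <;> linarith
        nlinarith [norm_nonneg (B n)]
      exact ⟨_, by simpa only [Finset.sum_range_succ] using hK.add h3⟩
  obtain ⟨K, hK⟩ := h1
  obtain ⟨K', hK'⟩ := h2 D.n
  exact ⟨K + K', hK.sub hK'.lipschitzOnWith⟩

end PieceData

/-! ### The explicit solution beyond R. -/

section JostTail

/-- The function `(1 + 2 c x) ^ σ`. -/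
noncomputable def jostTail (c : ℝ) (σ : ℂ) (x : ℝ) : ℂ :=
  Complex.exp (σ * (Real.log (1 + 2 * c * x) : ℝ))

/-- The quasi-derivative of `(1 + 2 c x) ^ σ`. -/
noncomputable def jostQuasi (c : ℝ) (σ : ℂ) (x : ℝ) : ℂ :=
  (2 * c * σ + 4 * c ^ 2 * (σ - σ ^ 2) * x) / (1 + 2 * c * x : ℝ) * jostTail c σ x

variable {c : ℝ} {σ : ℂ} {x : ℝ}

lemma jostTail_eq_cpow (hx : 0 < 1 + 2 * c * x) :
    jostTail c σ x = ((1 + 2 * c * x : ℝ) : ℂ) ^ σ := by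
  rw [jostTail, Complex.cpow_def_of_ne_zero (by exact_mod_cast hx.ne'), Complex.ofReal_log hx.le,
    mul_comm]

lemma hasDerivAt_jostTail (hx : 0 < 1 + 2 * c * x) :
    HasDerivAt (jostTail c σ) (2 * c * σ / (1 + 2 * c * x : ℝ) * jostTail c σ x) x := by
  have h1 : HasDerivAt (fun y : ℝ => 1 + 2 * c * y) (2 * c) x := by
    simpa using ((hasDerivAt_id x).const_mul (2 * c)).const_add 1
  have h2 := ((h1.log hx.ne').ofReal_comp.const_mul σ).cexp
  refine h2.congr_deriv ?_
  rw [jostTail]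
  push_cast
  ring

/-- `jostQuasi` is q = u' + z w u for u = (1 + 2cx)^σ, w = x/(1 + 2cx) and z = 4c²(σ - σ²). The
relation q' = z w u' is the differential equation with `υ` = 0. -/
lemma hasDerivAt_jostQuasi (hx : 0 < 1 + 2 * c * x) :
    HasDerivAt (jostQuasi c σ) (4 * c ^ 2 * (σ - σ ^ 2) * ((x / (1 + 2 * c * x) : ℝ) : ℂ)
      * (2 * c * σ / (1 + 2 * c * x : ℝ) * jostTail c σ x)) x := by
  have h1 : HasDerivAt (fun y : ℝ => ((1 + 2 * c * y : ℝ) : ℂ)) ((2 * c : ℝ) : ℂ) x := by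
    have : HasDerivAt (fun y : ℝ => 1 + 2 * c * y) (2 * c) x := by
      simpa using ((hasDerivAt_id x).const_mul (2 * c)).const_add 1
    exact this.ofReal_comp
  have h3 : HasDerivAt (fun y : ℝ => 2 * c * σ + 4 * c ^ 2 * (σ - σ ^ 2) * (y : ℂ))
      (4 * c ^ 2 * (σ - σ ^ 2) * 1) x :=
    ((hasDerivAt_id x).ofReal_comp.const_mul _).const_add _
  have hne : ((1 + 2 * c * x : ℝ) : ℂ) ≠ 0 := by exact_mod_cast hx.ne'
  have h4 := (h3.div h1 hne).mul (hasDerivAt_jostTail (σ := σ) hx)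
  refine h4.congr_deriv ?_
  simp only [Pi.div_apply]
  push_cast at hne ⊢
  field_simp
  ring

lemma one_add_mul_pos (hc : 0 < c) (hx : 0 ≤ x) : 0 < 1 + 2 * c * x := by positivity

lemma contDiffOn_jostTail (hc : 0 < c) : ContDiffOn ℝ 1 (jostTail c σ) (Ici 0) := by
  have h1 : ContDiffOn ℝ 1 (fun x : ℝ => Real.log (1 + 2 * c * x)) (Ici 0) :=
    ContDiffOn.log (by fun_prop) fun x hx => (one_add_mul_pos hc hx).ne'
  exact (contDiffOn_const.mul (Complex.ofRealCLM.contDiff.comp_contDiffOn h1)).cexp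

lemma contDiffOn_jostQuasi (hc : 0 < c) : ContDiffOn ℝ 1 (jostQuasi c σ) (Ici 0) := by
  have h1 : ContDiff ℝ 1 fun x : ℝ => ((1 + 2 * c * x : ℝ) : ℂ) :=
    Complex.ofRealCLM.contDiff.comp (contDiff_const.add (contDiff_const.mul contDiff_id))
  have h2 : ContDiff ℝ 1 fun x : ℝ => (2 * c * σ + 4 * c ^ 2 * (σ - σ ^ 2) * (x : ℂ)) :=
    contDiff_const.add (contDiff_const.mul Complex.ofRealCLM.contDiff)
  have h3 := (h2.contDiffOn (s := Ici (0:ℝ))).mul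
    (h1.contDiffOn.inv fun x hx => by exact_mod_cast (one_add_mul_pos hc hx).ne')
  exact h3.mul (contDiffOn_jostTail hc)

lemma exists_lipschitzOnWith_jostTail (hc : 0 < c) {R : ℝ} (hR : 0 ≤ R) (b : ℝ) :
    ∃ K, LipschitzOnWith K (jostTail c σ) (Icc R b) :=
  ((contDiffOn_jostTail hc).mono fun _ hx => hR.trans hx.1).exists_lipschitzOnWith
    (by decide) (convex_Icc _ _) isCompact_Icc

/-- With q' = z w u' one gets (q h)' = u' h' + z w (u h)', so the left-hand side is the integral of
an exact derivative, and `h` vanishes far out. -/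
lemma jostTail_weak_identity (hc : 0 < c) {S : HalfLineString} {R : ℝ} (hR : 0 ≤ R)
    (hw : ∀ᵐ x ∂volume.restrict (Ici R), S.w x = x / (1 + 2 * c * x)) {f h : ℝ → ℂ}
    (hf : MemH1loc f) (hfR : ∀ x, R ≤ x → f x = jostTail c σ x) (hh : MemH1c h) :
    (∫ x in Ioi R, deriv f x * deriv h x)
      + 4 * c ^ 2 * (σ - σ ^ 2) * (∫ x in Ioi R, (S.w x : ℂ) * deriv (fun y => f y * h y) x)
    = -(jostQuasi c σ R * h R) := by
  obtain ⟨b₀, hb₀, hb₁⟩ := hh.exists_nonneg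
  obtain ⟨b, hRb, hb0, hb⟩ : ∃ b, R ≤ b ∧ 0 ≤ b ∧ ∀ x, b ≤ x → h x = 0 :=
    ⟨max b₀ R, le_max_right _ _, hb₀.trans (le_max_left _ _),
      fun x hx => hb₁ x ((le_max_left _ _).trans hx)⟩
  have hfh : ∀ x, b ≤ x → f x * h x = 0 := fun x hx => by rw [hb x hx, mul_zero]
  have hi1 := (hh.integrableOn_deriv_mul_deriv hf).mono_set (Ioi_subset_Ioi hR)
  have hi2 := ((MemH1c.mul_left hf hh).integrableOn_w_mul_deriv S).mono_set (Ioi_subset_Ioi hR)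
  have hq : AbsolutelyContinuousOnInterval (jostQuasi c σ) R b := by
    refine ((contDiffOn_jostQuasi hc).mono ?_).absolutelyContinuousOnInterval
    rw [uIcc_of_le hRb]
    exact fun x hx => hR.trans hx.1
  have hhac := hh.1.absolutelyContinuousOnInterval hR hb0
  have hfac := hf.absolutelyContinuousOnInterval hR hb0
  have hft := (hq.complex_mul hhac).complex_integral_deriv_eq_sub
  rw [hb b le_rfl, mul_zero, zero_sub] at hft
  rw [← hft, ← integral_const_mul, ← integral_add hi1 (hi2.const_mul _),
    intervalIntegral.integral_of_le hRb,
    setIntegral_eq_of_subset_of_forall_sdiff_eq_zero measurableSet_Ioi Ioc_subset_Ioi_self]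
  · refine integral_congr_ae ?_
    have hw' := ae_restrict_of_ae_restrict_of_subset
      (Ioc_subset_Icc_self.trans Icc_subset_Ici_self : Ioc R b ⊆ Ici R) hw
    filter_upwards [hw', ae_restrict_mem measurableSet_Ioc,
      ae_restrict_of_ae hhac.complex_ae_differentiableAt] with x h1 hx h2
    have hxp : 0 < 1 + 2 * c * x := one_add_mul_pos hc (hR.trans hx.1.le)
    have hh' := (h2 (Icc_subset_uIcc (Ioc_subset_Icc_self hx))).hasDerivAt
    have hf' : HasDerivAt f (2 * c * σ / (1 + 2 * c * x : ℝ) * jostTail c σ x) x := by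
      refine (hasDerivAt_jostTail hxp).congr_of_eventuallyEq ?_
      filter_upwards [Ioi_mem_nhds hx.1] with y hy using hfR y (le_of_lt hy)
    have e1 := ((hasDerivAt_jostQuasi (σ := σ) hxp).mul hh').deriv
    have e2 := (hf'.mul hh').deriv
    simp only [Pi.mul_def] at e1 e2
    rw [e1, e2, hf'.deriv, h1,
      hfR x hx.1.le, jostQuasi]
    have hne : ((1 + 2 * c * x : ℝ) : ℂ) ≠ 0 := by exact_mod_cast hxp.ne'
    push_cast at hne ⊢
    field_simp
    ring
  · intro x hx
    have hbx : b < x := by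
      by_contra! hcon
      exact hx.2 ⟨hx.1, hcon⟩
    rw [deriv_eq_zero_of_eq_zero_on_Ici hb hbx, deriv_eq_zero_of_eq_zero_on_Ici hfh hbx]
    simp

end JostTail

/-! ### Gluing at R, and the Wronskian. -/

namespace PieceData

variable {S : HalfLineString} {R : ℝ} {D : PieceData S R} {c : ℝ} {σ z : ℂ} {f g : ℕ → ℂ}

lemma intervalIntegral_add_Ioi {F : ℝ → ℂ} (hR : 0 ≤ R) (hF : IntegrableOn F (Ioi 0)) :
    (∫ x in (0:ℝ)..R, F x) + ∫ x in Ioi R, F x = ∫ x in Ioi 0, F x := by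
  refine intervalIntegral.integral_interval_add_Ioi ?_ (hF.mono_set (Ioi_subset_Ioi hR))
  exact hF

/-- The boundary terms at R from the two sides cancel when value and quasi-derivative match, and `g
0` is left over as f'(0-). -/
lemma IsNodal.isSolution_glue (hc : 0 < c) (hR : 0 < R)
    (hw : ∀ᵐ x ∂volume.restrict (Ici R), S.w x = x / (1 + 2 * c * x))
    (hz : z = 4 * c ^ 2 * (σ - σ ^ 2)) (hN : D.IsNodal z f g)
    (hf : f D.n = jostTail c σ R) (hg : g D.n = jostQuasi c σ R) :
    S.IsSolution z (D.glue (D.slope z f g) (jostTail c σ)) (g 0) := by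
  set φ := D.glue (D.slope z f g) (jostTail c σ)
  have hφ : MemH1loc φ := memH1loc_glue _ (exists_lipschitzOnWith_jostTail hc hR.le)
  refine ⟨hφ, fun h hh => ?_⟩
  have h1 := hN.weak_identity hR.le (fun i hi x hx => hN.glue_eq hf.symm hi hx) hφ hh.1
  have h2 := jostTail_weak_identity hc hR.le hw hφ (fun x hx => glue_of_le hx) hh
  rw [HalfLineString.omega,
    ← intervalIntegral_add_Ioi hR.le (hh.integrableOn_deriv_mul_deriv hφ),
    ← intervalIntegral_add_Ioi hR.le ((MemH1c.mul_left hφ hh).integrableOn_w_mul_deriv S)]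
  rw [← hz] at h2
  rw [hg] at h1
  linear_combination h1 + h2

/-- A compactly supported continuation of a solution on `[0, R]`. -/
lemma IsNodal.exists_memH1c (hR : 0 < R) (hN : D.IsNodal z f g) :
    ∃ φ : ℝ → ℂ, MemH1c φ ∧ φ 0 = f 0 ∧ φ R = f D.n ∧
      ∀ i < D.n, ∀ x ∈ Icc (D.s i) (D.s (i + 1)),
        φ x = f (i + 1) + (x - D.s (i + 1)) * D.slope z f g i := by
  let Φ : ℝ → ℂ := fun x => (max 0 (1 - (x - R)) : ℝ) * f D.n
  have hΦ : Φ R = f D.n := by simp [Φ]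
  have hlip : ∀ b, ∃ K, LipschitzOnWith K Φ (Icc R b) := fun b => by
    refine ⟨‖f D.n‖₊, LipschitzOnWith.of_dist_le_mul fun x _ y _ => ?_⟩
    rw [dist_eq_norm, ← sub_mul, ← Complex.ofReal_sub, norm_mul, Complex.norm_real,
      Real.norm_eq_abs, mul_comm, coe_nnnorm, Real.dist_eq]
    refine mul_le_mul_of_nonneg_left ?_ (norm_nonneg _)
    have := abs_max_sub_max_le_abs (1 - (x - R)) (1 - (y - R)) 0
    rw [max_comm, max_comm 0]
    refine this.trans (le_of_eq ?_)
    rw [abs_sub_comm]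
    congr 1
    ring
  refine ⟨D.glue (D.slope z f g) Φ, ⟨memH1loc_glue _ hlip, R + 1, fun x hx => ?_⟩,
    hN.glue_zero hR hΦ, ?_, fun i hi x hx => hN.glue_eq hΦ hi hx⟩
  · rw [glue_of_le (by linarith)]
    simp only [Φ]
    rw [max_eq_left (by linarith)]
    simp
  · rw [glue_of_le le_rfl, hΦ]

/-- The Wronskian of a Jost solution with a solution `θ` on `[0, R]` is constant. -/
lemma IsNodal.wronskian (hc : 0 < c) (hR : 0 < R)
    (hw : ∀ᵐ x ∂volume.restrict (Ici R), S.w x = x / (1 + 2 * c * x))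
    (hz : z = 4 * c ^ 2 * (σ - σ ^ 2)) (hN : D.IsNodal z f g) {u : ℝ → ℂ} {d : ℂ}
    (hu : S.IsSolution z u d) (huR : ∀ x, R ≤ x → u x = jostTail c σ x) :
    d * f 0 - g 0 * u 0 = jostQuasi c σ R * f D.n - g D.n * jostTail c σ R := by
  obtain ⟨φ, hφ, hφ0, hφR, hφp⟩ := hN.exists_memH1c hR
  -- The equation for u is tested with φ and the nodal identity for φ with u. The bilinear terms on
  -- [0, R] agree, so only boundary terms remain.
  have h0 := hu.2 φ hφ
  have h1 := hN.weak_identity hR.le hφp hφ.1 hu.1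
  have h2 := jostTail_weak_identity hc hR.le hw hu.1 huR hφ
  rw [HalfLineString.omega,
    ← intervalIntegral_add_Ioi hR.le (hφ.integrableOn_deriv_mul_deriv hu.1),
    ← intervalIntegral_add_Ioi hR.le ((MemH1c.mul_left hu.1 hφ).integrableOn_w_mul_deriv S),
    hφ0] at h0
  simp only [mul_comm (φ _), mul_comm (deriv φ _)] at h1
  rw [← hz, hφR] at h2
  rw [huR R le_rfl] at h1
  linear_combination h0 - h1 - h2

end PieceData

/-! ### The Jost solution as polynomials in σ, and reality of the zeros. -/

section JostPolynomial

open Polynomial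

lemma exists_backward_recursion {A : Type*} (step : ℕ → A → A) (n : ℕ) (a : A) :
    ∃ u : ℕ → A, u n = a ∧ ∀ i < n, u i = step i (u (i + 1)) := by
  induction n generalizing a with
  | zero => exact ⟨fun _ => a, rfl, fun i hi => absurd hi (Nat.not_lt_zero i)⟩
  | succ n ih =>
    obtain ⟨u, hu, hu'⟩ := ih (step n a)
    refine ⟨Function.update u (n + 1) a, Function.update_self .., fun i hi => ?_⟩
    rw [Function.update_of_ne (by omega)]
    rcases Nat.lt_succ_iff_lt_or_eq.1 hi with h | rfl
    · rw [Function.update_of_ne (by omega)]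
      exact hu' i h
    · rw [Function.update_self, hu]

/-- The spectral parameter `z = 4 c² (σ - σ²)` as a polynomial in `σ`. -/
noncomputable def zPoly (c : ℝ) : ℝ[X] := C (4 * c ^ 2) * (X - X ^ 2)

lemma aeval_zPoly (c : ℝ) (σ : ℂ) : aeval σ (zPoly c) = 4 * c ^ 2 * (σ - σ ^ 2) := by
  simp [zPoly]

/-- Since z vanishes at σ = 0 to first order, each factor z lowers by one the order to which the
other factor has to be known. -/
lemma coeff_zPoly_mul (c : ℝ) (P : ℝ[X]) :
    (zPoly c * P).coeff 0 = 0 ∧ (zPoly c * P).coeff 1 = 4 * c ^ 2 * P.coeff 0 ∧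
      (zPoly c * P).coeff 2 = 4 * c ^ 2 * (P.coeff 1 - P.coeff 0) := by
  have h : zPoly c * P = C (4 * c ^ 2) * (X * P - X * (X * P)) := by rw [zPoly]; ring
  rw [h]
  refine ⟨?_, ?_, ?_⟩ <;> rw [coeff_C_mul, coeff_sub]
  · simp
  · rw [show (1:ℕ) = 0 + 1 from rfl, coeff_X_mul, coeff_X_mul]; simp
  · have h1 : (X * P).coeff 2 = P.coeff 1 := coeff_X_mul P 1
    have h2 : (X * (X * P)).coeff 2 = P.coeff 0 :=
      (coeff_X_mul (X * P) 1).trans (coeff_X_mul P 0)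
    rw [h1, h2]

namespace PieceData

variable {S : HalfLineString} {R : ℝ} (D : PieceData S R)

/-- The polynomial counterpart of `PieceData.slope`. -/
noncomputable def polySlope (c : ℝ) (F G : ℕ → ℝ[X]) (i : ℕ) : ℝ[X] :=
  G (i + 1) - zPoly c * (C (D.c i) * F (i + 1))

/-- The values `F i` and quasi-derivatives `G i` at `s i` of the Jost solution, divided by its
value at `R`, as polynomials in `σ`. -/
structure IsPolyNodal (c : ℝ) (F G : ℕ → ℝ[X]) : Prop where
  F_n : F D.n = 1
  G_n : G D.n = C (1 + 2 * c * R)⁻¹ * (C (2 * c) * X + zPoly c * C R)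
  F_eq : ∀ i < D.n, F i = F (i + 1) - C (D.s (i + 1) - D.s i) * D.polySlope c F G i
  G_eq : ∀ i < D.n, G i = D.polySlope c F G i + zPoly c * (C (D.c i) * F i)
    + zPoly c * (zPoly c * (C (D.m i) * F i))

lemma exists_isPolyNodal (c : ℝ) : ∃ F G : ℕ → ℝ[X], D.IsPolyNodal c F G := by
  let step : ℕ → ℝ[X] × ℝ[X] → ℝ[X] × ℝ[X] := fun i p =>
    let B := p.2 - zPoly c * (C (D.c i) * p.1)
    let f := p.1 - C (D.s (i + 1) - D.s i) * B
    (f, B + zPoly c * (C (D.c i) * f) + zPoly c * (zPoly c * (C (D.m i) * f)))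
  obtain ⟨u, hu, hu'⟩ := exists_backward_recursion step D.n
    (1, C (1 + 2 * c * R)⁻¹ * (C (2 * c) * X + zPoly c * C R))
  refine ⟨fun i => (u i).1, fun i => (u i).2, by rw [hu], by rw [hu], fun i hi => ?_,
    fun i hi => ?_⟩
  · simp only [hu' i hi, step, polySlope]
  · simp only [hu' i hi, step, polySlope]

variable {D} {c : ℝ} {F G : ℕ → ℝ[X]}

lemma aeval_polySlope (σ e : ℂ) (i : ℕ) :
    D.slope (4 * c ^ 2 * (σ - σ ^ 2)) (fun i => e * aeval σ (F i)) (fun i => e * aeval σ (G i)) i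
      = e * aeval σ (D.polySlope c F G i) := by
  simp only [slope, polySlope, map_sub, map_mul, aeval_zPoly, aeval_C, Complex.coe_algebraMap]
  ring

lemma IsPolyNodal.isNodal (h : D.IsPolyNodal c F G) (σ e : ℂ) :
    D.IsNodal (4 * c ^ 2 * (σ - σ ^ 2)) (fun i => e * aeval σ (F i))
      (fun i => e * aeval σ (G i)) := by
  intro i hi
  rw [aeval_polySlope]
  constructor
  · simp only []
    rw [h.F_eq i hi]
    simp only [map_sub, map_mul, aeval_C, Complex.coe_algebraMap]
    push_cast
    ring
  · simp only []
    rw [h.G_eq i hi]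
    simp only [map_add, map_mul, aeval_zPoly, aeval_C, Complex.coe_algebraMap]
    ring

variable (c F G) in
/-- The polynomial `Q` with `2 i k a(k) = (1 + 2 c R) ^ σ * Q σ`. -/
noncomputable def jostPoly : ℝ[X] := C (2 * c) * (X - 1) * F 0 + G 0

lemma IsPolyNodal.f_n (h : D.IsPolyNodal c F G) (σ : ℂ) :
    jostTail c σ R * aeval σ (F D.n) = jostTail c σ R := by
  rw [h.F_n, map_one, mul_one]

lemma IsPolyNodal.g_n (h : D.IsPolyNodal c F G) (σ : ℂ) :
    jostTail c σ R * aeval σ (G D.n) = jostQuasi c σ R := by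
  rw [h.G_n, jostQuasi]
  simp only [map_add, map_mul, aeval_zPoly, aeval_C, aeval_X, Complex.coe_algebraMap]
  push_cast
  ring

lemma IsPolyNodal.exists_solution (h : D.IsPolyNodal c F G) (hc : 0 < c) (hR : 0 < R)
    (hw : ∀ᵐ x ∂volume.restrict (Ici R), S.w x = x / (1 + 2 * c * x)) (σ : ℂ) :
    ∃ u d, S.IsSolution (4 * c ^ 2 * (σ - σ ^ 2)) u d ∧ (∀ x, R ≤ x → u x = jostTail c σ x) ∧
      d + 2 * c * (σ - 1) * u 0 = jostTail c σ R * aeval σ (jostPoly c F G) := by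
  have hN := h.isNodal σ (jostTail c σ R)
  refine ⟨_, _, hN.isSolution_glue hc hR hw rfl (h.f_n σ) (h.g_n σ), fun x hx => glue_of_le hx, ?_⟩
  rw [hN.glue_zero hR (h.f_n σ).symm, jostPoly]
  simp only [map_add, map_mul, map_sub, map_one, aeval_C, aeval_X, Complex.coe_algebraMap]
  push_cast
  ring

/-- Uniqueness of the Jost solution is bypassed: the combination entering `a` is the Wronskian at 0
with the nodal solution with data 1 and -2c(σ - 1), and that Wronskian depends only on the tail
beyond R. -/
lemma IsPolyNodal.solution_value (h : D.IsPolyNodal c F G) (hc : 0 < c) (hR : 0 < R)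
    (hw : ∀ᵐ x ∂volume.restrict (Ici R), S.w x = x / (1 + 2 * c * x)) {σ : ℂ} {u : ℝ → ℂ} {d : ℂ}
    (hu : S.IsSolution (4 * c ^ 2 * (σ - σ ^ 2)) u d) (huR : ∀ x, R ≤ x → u x = jostTail c σ x) :
    d + 2 * c * (σ - 1) * u 0 = jostTail c σ R * aeval σ (jostPoly c F G) := by
  obtain ⟨v, e, hv, hvR, hve⟩ := h.exists_solution hc hR hw σ
  obtain ⟨f, g, hN, hf0, hg0⟩ :=
    D.exists_isNodal (4 * c ^ 2 * (σ - σ ^ 2)) 1 (-(2 * c * (σ - 1)))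
  have h1 := hN.wronskian hc hR hw rfl hu huR
  have h2 := hN.wronskian hc hR hw rfl hv hvR
  rw [hf0, hg0] at h1 h2
  rw [← hve]
  linear_combination h1 - h2

/-- The discrete Lagrange identity: across one interval and one mass, Im(conj f · g/z) changes by Im
z times a nonnegative energy, made up of the squared slope over z and the mass weighted by |f|². -/
lemma IsNodal.im_step {z : ℂ} {f g : ℕ → ℂ} (hN : D.IsNodal z f g) (hz : z ≠ 0) {i : ℕ}
    (hi : i < D.n) : ∃ r : ℝ, 0 ≤ r ∧
      (starRingEnd ℂ (f i) * (g i / z)).im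
        = (starRingEnd ℂ (f (i + 1)) * (g (i + 1) / z)).im + z.im * r := by
  set p := D.slope z f g i / z with hp
  have hs : D.slope z f g i = z * p := by rw [hp]; field_simp
  obtain ⟨h1, h2⟩ := hN i hi
  have h3 : f (i + 1) = f i + (D.s (i + 1) - D.s i : ℝ) * (z * p) := by
    rw [h1, hs]; ring
  have h4 : g (i + 1) / z = p + D.c i * f (i + 1) := by
    have : g (i + 1) = D.slope z f g i + z * D.c i * f (i + 1) := by rw [slope]; ring
    rw [this, hs]; field_simp
  have h5 : g i / z = p + D.c i * f i + z * D.m i * f i := by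
    rw [h2, hs]; field_simp
  refine ⟨(D.s (i + 1) - D.s i) * Complex.normSq p + D.m i * Complex.normSq (f i), ?_, ?_⟩
  · have := sub_nonneg.2 (D.s_le_succ i)
    have := D.m_nonneg i
    have := Complex.normSq_nonneg p
    have := Complex.normSq_nonneg (f i)
    positivity
  · rw [h4, h5, h3]
    generalize D.s (i + 1) - D.s i = l
    simp only [Complex.normSq_apply, Complex.mul_im, Complex.mul_re, Complex.add_re,
      Complex.add_im, Complex.conj_re, Complex.conj_im, Complex.ofReal_re, Complex.ofReal_im]
    ring

lemma IsNodal.im_eq {z : ℂ} {f g : ℕ → ℂ} (hN : D.IsNodal z f g) (hz : z ≠ 0) :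
    ∃ r : ℝ, 0 ≤ r ∧ (starRingEnd ℂ (f 0) * (g 0 / z)).im
        = (starRingEnd ℂ (f D.n) * (g D.n / z)).im + z.im * r := by
  have key : ∀ i ≤ D.n, ∃ r : ℝ, 0 ≤ r ∧ (starRingEnd ℂ (f 0) * (g 0 / z)).im
        = (starRingEnd ℂ (f i) * (g i / z)).im + z.im * r := by
    intro i
    induction i with
    | zero => exact fun _ => ⟨0, le_rfl, by simp⟩
    | succ i ih =>
      intro hi
      obtain ⟨r, hr, h⟩ := ih (by omega)
      obtain ⟨r', hr', h'⟩ := hN.im_step hz (i := i) (by omega)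
      exact ⟨r + r', by positivity, by rw [h, h']; ring⟩
  exact key D.n le_rfl

/-- At a root, g(0) = 2c(1 - σ) f(0), so Im(conj f · g/z) at 0 is -Im σ times a nonnegative number.
At R it is Im σ times a positive number, and the energy between enters with Im z = 4c²(1 - 2 Re σ)
Im σ. All terms collect on one side with the same sign, so Im σ ≠ 0 is impossible. -/
lemma IsPolyNodal.im_eq_zero (h : D.IsPolyNodal c F G) (hc : 0 < c) (hR : 0 < R) {σ : ℂ}
    (hσ : σ.re < 1 / 2) (h0 : aeval σ (jostPoly c F G) = 0) : σ.im = 0 := by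
  by_contra him
  have hσ0 : σ ≠ 0 := by rintro rfl; simp at him
  have hσ1 : 1 - σ ≠ 0 := by
    intro h; have := congrArg Complex.im h; simp at this; exact him this
  have hcC : (c : ℂ) ≠ 0 := by exact_mod_cast hc.ne'
  set z : ℂ := 4 * c ^ 2 * (σ - σ ^ 2) with hz
  have hz' : z = 4 * c ^ 2 * σ * (1 - σ) := by rw [hz]; ring
  have hz0 : z ≠ 0 := by rw [hz']; simp [hcC, hσ0, hσ1]
  have hN := h.isNodal σ 1
  obtain ⟨r, hr, hrel⟩ := hN.im_eq hz0
  have hℓ : 0 < 1 + 2 * c * R := by positivity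
  have hℓC : (1 + 2 * c * R : ℂ) ≠ 0 := by exact_mod_cast hℓ.ne'
  simp only [one_mul] at hrel
  rw [h.F_n, h.G_n] at hrel
  have hG0 : aeval σ (G 0) = 2 * c * (1 - σ) * aeval σ (F 0) := by
    rw [jostPoly] at h0
    simp only [map_add, map_mul, map_sub, map_one, aeval_C, aeval_X, Complex.coe_algebraMap] at h0
    push_cast at h0
    linear_combination h0
  have e1 : starRingEnd ℂ (aeval σ (F 0)) * (aeval σ (G 0) / z)
      = ((Complex.normSq (aeval σ (F 0)) / (2 * c) : ℝ) : ℂ) * σ⁻¹ := by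
    rw [hG0, hz']
    push_cast
    rw [Complex.normSq_eq_conj_mul_self]
    field_simp
    ring
  have e2 : starRingEnd ℂ (aeval σ (1 : ℝ[X])) *
        (aeval σ (C (1 + 2 * c * R)⁻¹ * (C (2 * c) * X + zPoly c * C R)) / z)
      = ((1 / (2 * c * (1 + 2 * c * R)) : ℝ) : ℂ) * (1 - σ)⁻¹ + (R / (1 + 2 * c * R) : ℝ) := by
    simp only [map_add, map_mul, map_one, aeval_zPoly, aeval_C, aeval_X, Complex.coe_algebraMap]
    rw [← hz]
    push_cast
    have : (2 * c * σ + z * R) / z = 1 / (2 * c * (1 - σ)) + R := by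
      rw [hz']; field_simp; ring
    rw [mul_div_assoc, this]
    field_simp
  rw [e1, e2] at hrel
  have hzim : z.im = σ.im * (4 * c ^ 2 * (1 - 2 * σ.re)) := by
    have : z = ((4 * c ^ 2 : ℝ) : ℂ) * (σ - σ ^ 2) := by rw [hz]; push_cast; ring
    rw [this, Complex.im_ofReal_mul, Complex.sub_im, sq σ, Complex.mul_im]
    ring
  rw [← hz, hzim, Complex.add_im, Complex.ofReal_im, Complex.im_ofReal_mul, Complex.im_ofReal_mul,
    Complex.inv_im, Complex.inv_im] at hrel
  have h1 : 0 ≤ Complex.normSq (aeval σ (F 0)) / (2 * c) / Complex.normSq σ := by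
    have := Complex.normSq_nonneg (aeval σ (F 0))
    have := Complex.normSq_nonneg σ
    positivity
  have h2 : 0 < 1 / (2 * c * (1 + 2 * c * R)) / Complex.normSq (1 - σ) := by
    have := Complex.normSq_pos.2 hσ1
    positivity
  have h3 : 0 ≤ 4 * c ^ 2 * (1 - 2 * σ.re) * r := by
    have : 0 ≤ 1 - 2 * σ.re := by linarith
    positivity
  have h4 : σ.im * (Complex.normSq (aeval σ (F 0)) / (2 * c) / Complex.normSq σ
      + 1 / (2 * c * (1 + 2 * c * R)) / Complex.normSq (1 - σ)
      + 4 * c ^ 2 * (1 - 2 * σ.re) * r) = 0 := by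
    simp only [Complex.sub_im, Complex.one_im] at hrel
    linear_combination -hrel
  rcases mul_eq_zero.1 h4 with h | h
  · exact him h
  · linarith

end PieceData

end JostPolynomial

/-! ### Taylor coefficients at σ = 0, where z = 0. -/

section JostTaylor

open Polynomial

namespace PieceData

variable {S : HalfLineString} {R : ℝ} {D : PieceData S R} {c : ℝ} {F G : ℕ → ℝ[X]}

lemma IsPolyNodal.coeff_n (h : D.IsPolyNodal c F G) (hR : 0 < R) (hc : 0 < c) :
    (F D.n).coeff 0 = 1 ∧ (F D.n).coeff 1 = 0 ∧ (F D.n).coeff 2 = 0 ∧ (G D.n).coeff 0 = 0 ∧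
      (G D.n).coeff 1 = 2 * c ∧ (G D.n).coeff 2 = -(4 * c ^ 2 * R) / (1 + 2 * c * R) := by
  obtain ⟨z0, z1, z2⟩ := coeff_zPoly_mul c (C R)
  have hℓ : 1 + 2 * c * R ≠ 0 := by positivity
  have x0 : (X : ℝ[X]).coeff 0 = 0 := coeff_X_zero
  have x1 : (X : ℝ[X]).coeff 1 = 1 := coeff_X_one
  have x2 : (X : ℝ[X]).coeff 2 = 0 := coeff_X_of_ne_one (by norm_num)
  have c1 : (C R).coeff 1 = 0 := coeff_C_of_ne_zero one_ne_zero
  rw [h.F_n, h.G_n]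
  refine ⟨coeff_one_zero, by simp [coeff_one], by simp [coeff_one], ?_, ?_, ?_⟩
  · rw [coeff_C_mul, coeff_add, coeff_C_mul, z0, x0]; simp
  · rw [coeff_C_mul, coeff_add, coeff_C_mul, z1, x1, coeff_C_zero]; field_simp; ring
  · rw [coeff_C_mul, coeff_add, coeff_C_mul, z2, x2, c1, coeff_C_zero]; field_simp; ring

/-- The last combination is adapted to log(-Q/(2c)), whose second Taylor coefficient it gives at s =
0 up to the constant -2. The weight 1 + 2cs makes the unknown coefficients of F and G cancel from
the increment, which then depends only on the data of the string. -/
lemma IsPolyNodal.coeff_step (h : D.IsPolyNodal c F G) (hc : 0 < c) {i : ℕ} (hi : i < D.n)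
    (hf0 : (F (i + 1)).coeff 0 = 1) (hg0 : (G (i + 1)).coeff 0 = 0)
    (hg1 : (G (i + 1)).coeff 1 = 2 * c) :
    (F i).coeff 0 = 1 ∧ (G i).coeff 0 = 0 ∧ (G i).coeff 1 = 2 * c ∧
    (F i).coeff 1 = (F (i + 1)).coeff 1 - (D.s (i + 1) - D.s i) * (2 * c - 4 * c ^ 2 * D.c i) ∧
    (F i).coeff 2 - (F i).coeff 1 ^ 2 / 2
        - ((G i).coeff 2 - 2 * c * (F i).coeff 1) * (1 + 2 * c * D.s i) / (2 * c)
      = (F (i + 1)).coeff 2 - (F (i + 1)).coeff 1 ^ 2 / 2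
        - ((G (i + 1)).coeff 2 - 2 * c * (F (i + 1)).coeff 1) * (1 + 2 * c * D.s (i + 1)) / (2 * c)
        - (4 * c ^ 2 * D.c i * (D.s (i + 1) - D.s i) + (2 * c - 4 * c ^ 2 * D.c i) ^ 2 / (2 * c)
            * (D.s (i + 1) - D.s i + c * (D.s (i + 1) ^ 2 - D.s i ^ 2)))
        - 8 * c ^ 3 * (D.m i * (1 + 2 * c * D.s i)) := by
  obtain ⟨a0, a1, a2⟩ := coeff_zPoly_mul c (C (D.c i) * F (i + 1))
  rw [coeff_C_mul, coeff_C_mul, hf0] at a2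
  rw [coeff_C_mul, hf0] at a1
  have b0 : (D.polySlope c F G i).coeff 0 = 0 := by rw [polySlope, coeff_sub, a0, hg0, sub_zero]
  have b1 : (D.polySlope c F G i).coeff 1 = 2 * c - 4 * c ^ 2 * D.c i := by
    rw [polySlope, coeff_sub, a1, hg1]; ring
  have b2 : (D.polySlope c F G i).coeff 2
      = (G (i + 1)).coeff 2 - 4 * c ^ 2 * (D.c i * (F (i + 1)).coeff 1 - D.c i) := by
    rw [polySlope, coeff_sub, a2]; ring
  have f0 : (F i).coeff 0 = 1 := by
    rw [h.F_eq i hi, coeff_sub, coeff_C_mul, b0, hf0]; ring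
  have f1 : (F i).coeff 1
      = (F (i + 1)).coeff 1 - (D.s (i + 1) - D.s i) * (2 * c - 4 * c ^ 2 * D.c i) := by
    rw [h.F_eq i hi, coeff_sub, coeff_C_mul, b1]
  have f2 : (F i).coeff 2 = (F (i + 1)).coeff 2 - (D.s (i + 1) - D.s i) *
      ((G (i + 1)).coeff 2 - 4 * c ^ 2 * (D.c i * (F (i + 1)).coeff 1 - D.c i)) := by
    rw [h.F_eq i hi, coeff_sub, coeff_C_mul, b2]
  obtain ⟨d0, d1, d2⟩ := coeff_zPoly_mul c (C (D.c i) * F i)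
  rw [coeff_C_mul, coeff_C_mul, f0] at d2
  rw [coeff_C_mul, f0] at d1
  obtain ⟨e0, e1, e2⟩ := coeff_zPoly_mul c (C (D.m i) * F i)
  rw [coeff_C_mul, f0] at e1
  obtain ⟨k0, k1, k2⟩ := coeff_zPoly_mul c (zPoly c * (C (D.m i) * F i))
  rw [e0] at k1
  rw [e0, e1] at k2
  have g0 : (G i).coeff 0 = 0 := by
    rw [h.G_eq i hi, coeff_add, coeff_add, b0, d0, k0]; ring
  have g1 : (G i).coeff 1 = 2 * c := by
    rw [h.G_eq i hi, coeff_add, coeff_add, b1, d1, k1]; ring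
  have g2 : (G i).coeff 2
      = (G (i + 1)).coeff 2 - 4 * c ^ 2 * (D.c i * (F (i + 1)).coeff 1 - D.c i)
        + 4 * c ^ 2 * (D.c i * (F i).coeff 1 - D.c i) + 16 * c ^ 4 * D.m i := by
    rw [h.G_eq i hi, coeff_add, coeff_add, b2, d2, k2]; ring
  refine ⟨f0, g0, g1, f1, ?_⟩
  rw [g2, f2, f1]
  field_simp
  ring

lemma IsPolyNodal.coeff_low (h : D.IsPolyNodal c F G) (hR : 0 < R) (hc : 0 < c) {i : ℕ}
    (hi : i ≤ D.n) :
    (F i).coeff 0 = 1 ∧ (G i).coeff 0 = 0 ∧ (G i).coeff 1 = 2 * c := by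
  induction hi using Nat.decreasingInduction with
  | self =>
    obtain ⟨h1, -, -, h2, h3, -⟩ := h.coeff_n hR hc
    exact ⟨h1, h2, h3⟩
  | of_succ i hi ih =>
    obtain ⟨h1, h2, h3, -⟩ := h.coeff_step hc hi ih.1 ih.2.1 ih.2.2
    exact ⟨h1, h2, h3⟩

lemma IsPolyNodal.coeff_one_eq_sum (h : D.IsPolyNodal c F G) (hR : 0 < R) (hc : 0 < c) :
    (F 0).coeff 1
      = -∑ i ∈ Finset.range D.n, (D.s (i + 1) - D.s i) * (2 * c - 4 * c ^ 2 * D.c i) := by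
  have h1 := Finset.sum_range_sub' (fun i => (F i).coeff 1) D.n
  rw [(h.coeff_n hR hc).2.1, sub_zero] at h1
  rw [← h1, ← Finset.sum_neg_distrib]
  refine Finset.sum_congr rfl fun i hi => ?_
  have hi' := Finset.mem_range.1 hi
  obtain ⟨k1, k2, k3⟩ := h.coeff_low hR hc (i := i + 1) hi'
  have := (h.coeff_step hc hi' k1 k2 k3).2.2.2.1
  linarith

lemma IsPolyNodal.coeff_two_eq_sum (h : D.IsPolyNodal c F G) (hR : 0 < R) (hc : 0 < c) :
    (F 0).coeff 2 - (F 0).coeff 1 ^ 2 / 2 - ((G 0).coeff 2 - 2 * c * (F 0).coeff 1) / (2 * c)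
      = 2 * c * R - (∑ i ∈ Finset.range D.n,
        (4 * c ^ 2 * D.c i * (D.s (i + 1) - D.s i) + (2 * c - 4 * c ^ 2 * D.c i) ^ 2 / (2 * c)
            * (D.s (i + 1) - D.s i + c * (D.s (i + 1) ^ 2 - D.s i ^ 2))))
        - 8 * c ^ 3 * ∑ i ∈ Finset.range D.n, D.m i * (1 + 2 * c * D.s i) := by
  have h1 := Finset.sum_range_sub' (fun i => (F i).coeff 2 - (F i).coeff 1 ^ 2 / 2
        - ((G i).coeff 2 - 2 * c * (F i).coeff 1) * (1 + 2 * c * D.s i) / (2 * c)) D.n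
  obtain ⟨-, n1, n2, -, -, n3⟩ := h.coeff_n hR hc
  simp only [n1, n2, n3, D.s_n, D.s_zero] at h1
  have hℓ : 1 + 2 * c * R ≠ 0 := by positivity
  have h2 : -(4 * c ^ 2 * R) / (1 + 2 * c * R) * (1 + 2 * c * R) / (2 * c) = -(2 * c * R) := by
    field_simp; ring
  have h3 : ∑ i ∈ Finset.range D.n, ((F i).coeff 2 - (F i).coeff 1 ^ 2 / 2
        - ((G i).coeff 2 - 2 * c * (F i).coeff 1) * (1 + 2 * c * D.s i) / (2 * c)
      - ((F (i + 1)).coeff 2 - (F (i + 1)).coeff 1 ^ 2 / 2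
        - ((G (i + 1)).coeff 2 - 2 * c * (F (i + 1)).coeff 1) * (1 + 2 * c * D.s (i + 1))
          / (2 * c)))
      = -(∑ i ∈ Finset.range D.n,
        (4 * c ^ 2 * D.c i * (D.s (i + 1) - D.s i) + (2 * c - 4 * c ^ 2 * D.c i) ^ 2 / (2 * c)
            * (D.s (i + 1) - D.s i + c * (D.s (i + 1) ^ 2 - D.s i ^ 2))))
        - 8 * c ^ 3 * ∑ i ∈ Finset.range D.n, D.m i * (1 + 2 * c * D.s i) := by
    rw [Finset.mul_sum, ← Finset.sum_neg_distrib, ← Finset.sum_sub_distrib]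
    refine Finset.sum_congr rfl fun i hi => ?_
    have hi' := Finset.mem_range.1 hi
    obtain ⟨k1, k2, k3⟩ := h.coeff_low hR hc (i := i + 1) hi'
    have := (h.coeff_step hc hi' k1 k2 k3).2.2.2.2
    rw [this]
    ring
  rw [h3] at h1
  simp only [mul_zero, sub_zero, add_zero, mul_one] at h1
  rw [h2] at h1
  linarith

lemma integral_comp_w {H : ℝ → ℝ → ℝ} (hi : IntegrableOn (fun x => H x (S.w x)) (Icc 0 R)) :
    ∫ x in (0:ℝ)..R, H x (S.w x)
      = ∑ i ∈ Finset.range D.n, ∫ x in D.s i..D.s (i + 1), H x (D.c i) := by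
  rw [← sum_integral_pieces (D := D) hi]
  refine Finset.sum_congr rfl fun i hi => ?_
  rw [intervalIntegral.integral_of_le (D.s_le_succ i),
    intervalIntegral.integral_of_le (D.s_le_succ i), integral_Ioc_eq_integral_Ioo,
    integral_Ioc_eq_integral_Ioo]
  refine integral_congr_ae ?_
  filter_upwards [D.w_eq i (Finset.mem_range.1 hi)] with x hx
  rw [hx]

end PieceData

lemma HalfLineString.integrableOn_w (S : HalfLineString) (R : ℝ) : IntegrableOn S.w (Icc 0 R) :=
  (S.memLp_w R).integrable one_le_two

lemma continuousOn_free (hc : 0 < c) (R : ℝ) :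
    ContinuousOn (fun x : ℝ => x / (1 + 2 * c * x)) (Icc 0 R) :=
  continuousOn_id.div (by fun_prop) fun x hx => (one_add_mul_pos hc hx.1).ne'

lemma HalfLineString.integrableOn_defect (S : HalfLineString) {c : ℝ} (hc : 0 < c) (R : ℝ) :
    IntegrableOn (fun x => S.w x - x / (1 + 2 * c * x)) (Icc 0 R) :=
  (S.integrableOn_w R).sub ((continuousOn_free hc R).integrableOn_Icc)

lemma HalfLineString.integrableOn_defect_sq (S : HalfLineString) {c : ℝ} (hc : 0 < c) (R : ℝ) :
    IntegrableOn (fun x => |S.w x - x / (1 + 2 * c * x)| ^ 2 * (1 + 2 * c * x)) (Icc 0 R) := by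
  have h1 : MemLp (fun x => S.w x - x / (1 + 2 * c * x)) 2 (volume.restrict (Icc 0 R)) := by
    refine (S.memLp_w R).sub ?_
    obtain ⟨C, hC⟩ := isCompact_Icc.exists_bound_of_continuousOn (continuousOn_free hc R)
    exact MemLp.of_bound ((continuousOn_free hc R).aestronglyMeasurable measurableSet_Icc) C
      ((ae_restrict_iff' measurableSet_Icc).2 (ae_of_all _ hC))
  have h2 : IntegrableOn (fun x => (S.w x - x / (1 + 2 * c * x)) ^ 2) (Icc 0 R) := h1.integrable_sq
  simp only [sq_abs]
  exact h2.mul_continuousOn (by fun_prop) isCompact_Icc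

lemma integrableOn_Ioi_and_integral_eq {H : ℝ → ℝ} {R : ℝ} (hR : 0 ≤ R)
    (hi : IntegrableOn H (Icc 0 R)) (h0 : ∀ᵐ x ∂volume.restrict (Ici R), H x = 0) :
    IntegrableOn H (Ioi 0) ∧ ∫ x in Ioi 0, H x = ∫ x in (0:ℝ)..R, H x := by
  have h1 : IntegrableOn H (Ici R) := by
    have : H =ᵐ[volume.restrict (Ici R)] fun _ => 0 := h0
    exact (integrable_congr this).2 (integrable_zero _ _ _)
  have h2 : IntegrableOn H (Ioi 0) := (hi.union h1).mono_set fun x hx => by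
    rcases le_or_gt x R with h | h
    · exact Or.inl ⟨le_of_lt hx, h⟩
    · exact Or.inr h.le
  refine ⟨h2, ?_⟩
  have h3 := intervalIntegral.integral_interval_add_Ioi (a := 0) (b := R) h2
    (h2.mono_set (Ioi_subset_Ioi hR))
  have h4 : ∫ x in Ioi R, H x = 0 := by
    have : ∀ᵐ x ∂volume.restrict (Ioi R), H x = 0 :=
      ae_restrict_of_ae_restrict_of_subset Ioi_subset_Ici_self h0
    exact integral_eq_zero_of_ae this
  rw [← h3, h4, add_zero]

namespace PieceData

variable {S : HalfLineString} {R : ℝ} {D : PieceData S R} {c : ℝ} {F G : ℕ → ℝ[X]}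

lemma integral_inv_one_add (hc : 0 < c) (hR : 0 ≤ R) :
    ∫ x in (0:ℝ)..R, 2 * c / (1 + 2 * c * x) = Real.log (1 + 2 * c * R) := by
  have h : ∀ x ∈ uIcc 0 R, HasDerivAt (fun y : ℝ => Real.log (1 + 2 * c * y))
      (2 * c / (1 + 2 * c * x)) x := by
    intro x hx
    rw [uIcc_of_le hR] at hx
    have h1 : HasDerivAt (fun y : ℝ => 1 + 2 * c * y) (2 * c) x := by
      simpa using ((hasDerivAt_id x).const_mul (2 * c)).const_add 1
    exact h1.log (one_add_mul_pos hc hx.1).ne'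
  rw [intervalIntegral.integral_eq_sub_of_hasDerivAt h]
  · simp
  · refine ContinuousOn.intervalIntegrable ?_
    rw [uIcc_of_le hR]
    exact continuousOn_const.div (by fun_prop) fun x hx => (one_add_mul_pos hc hx.1).ne'

/-- Comparison with the free w₀ = x/(1 + 2cx), for which 2c - 4c²w₀ = 2c/(1 + 2cx), produces the
logarithm. -/
lemma IsPolyNodal.coeff_one_eq (h : D.IsPolyNodal c F G) (hR : 0 < R) (hc : 0 < c) :
    (F 0).coeff 1 = 4 * c ^ 2 * (∫ x in (0:ℝ)..R, (S.w x - x / (1 + 2 * c * x)))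
      - Real.log (1 + 2 * c * R) := by
  have hi : IntegrableOn (fun x => 2 * c - 4 * c ^ 2 * S.w x) (Icc 0 R) :=
    (integrableOn_const (by simp)).sub ((S.integrableOn_w R).const_mul _)
  have h1 := integral_comp_w (D := D) (H := fun _ w => 2 * c - 4 * c ^ 2 * w) hi
  simp only [intervalIntegral.integral_const, smul_eq_mul] at h1
  rw [h.coeff_one_eq_sum hR hc, ← h1]
  have hd := S.integrableOn_defect hc R
  have hd' : IntervalIntegrable (fun x => S.w x - x / (1 + 2 * c * x)) volume 0 R :=
    (intervalIntegrable_iff_integrableOn_Icc_of_le hR.le).2 hd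
  have he : IntervalIntegrable (fun x => 2 * c / (1 + 2 * c * x)) volume 0 R := by
    refine ContinuousOn.intervalIntegrable ?_
    rw [uIcc_of_le hR.le]
    exact continuousOn_const.div (by fun_prop) fun x hx => (one_add_mul_pos hc hx.1).ne'
  rw [← integral_inv_one_add hc hR.le, ← intervalIntegral.integral_const_mul,
    ← intervalIntegral.integral_sub (hd'.const_mul _) he, ← intervalIntegral.integral_neg]
  refine intervalIntegral.integral_congr fun x hx => ?_
  rw [uIcc_of_le hR.le] at hx
  have := (one_add_mul_pos hc hx.1).ne'
  field_simp
  ring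

lemma IsPolyNodal.coeff_two_eq (h : D.IsPolyNodal c F G) (hR : 0 < R) (hc : 0 < c) :
    (F 0).coeff 2 - (F 0).coeff 1 ^ 2 / 2 - ((G 0).coeff 2 - 2 * c * (F 0).coeff 1) / (2 * c)
      = 4 * c ^ 2 * (∫ x in (0:ℝ)..R, (S.w x - x / (1 + 2 * c * x)))
        - 8 * c ^ 3 * ((∫ x in (0:ℝ)..R, |S.w x - x / (1 + 2 * c * x)| ^ 2 * (1 + 2 * c * x))
          + ∫ x in Ici 0, (1 + 2 * c * x) ∂S.υ) := by
  have hd := S.integrableOn_defect hc R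
  have hd2 := S.integrableOn_defect_sq hc R
  have hd' : IntervalIntegrable (fun x => S.w x - x / (1 + 2 * c * x)) volume 0 R :=
    (intervalIntegrable_iff_integrableOn_Icc_of_le hR.le).2 hd
  have hd2' : IntervalIntegrable
      (fun x => |S.w x - x / (1 + 2 * c * x)| ^ 2 * (1 + 2 * c * x)) volume 0 R :=
    (intervalIntegrable_iff_integrableOn_Icc_of_le hR.le).2 hd2
  -- Expansion of the integrand around w₀ = x/(1 + 2cx), where 1 - 2c w₀ = 1/(1 + 2cx). The
  -- zeroth-order part is the constant 2c, which cancels the term 2cR coming from the endpoint R.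
  have hpt : ∀ x ∈ Icc 0 R, 4 * c ^ 2 * S.w x + (2 * c - 4 * c ^ 2 * S.w x) ^ 2 / (2 * c)
      * (1 + 2 * c * x) = 2 * c - 4 * c ^ 2 * (S.w x - x / (1 + 2 * c * x))
        + 8 * c ^ 3 * (|S.w x - x / (1 + 2 * c * x)| ^ 2 * (1 + 2 * c * x)) := by
    intro x hx
    have := (one_add_mul_pos hc hx.1).ne'
    have hy : x / (1 + 2 * c * x) * (1 + 2 * c * x) = x := div_mul_cancel₀ _ this
    rw [sq_abs]
    generalize x / (1 + 2 * c * x) = y at hy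
    have e : (2 * c - 4 * c ^ 2 * S.w x) ^ 2 / (2 * c) = 2 * c * (1 - 2 * c * S.w x) ^ 2 := by
      field_simp; ring
    rw [e]
    linear_combination -(4 * c ^ 2 + 8 * c ^ 3 * (y - 2 * S.w x)) * hy
  have hi : IntegrableOn (fun x => 4 * c ^ 2 * S.w x + (2 * c - 4 * c ^ 2 * S.w x) ^ 2 / (2 * c)
      * (1 + 2 * c * x)) (Icc 0 R) := by
    refine (integrableOn_congr_fun hpt measurableSet_Icc).2 ?_
    exact ((integrableOn_const (by simp)).sub (hd.const_mul _)).add (hd2.const_mul _)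
  have h1 := integral_comp_w (D := D) (H := fun x w => 4 * c ^ 2 * w
    + (2 * c - 4 * c ^ 2 * w) ^ 2 / (2 * c) * (1 + 2 * c * x)) hi
  have h2 : ∀ i, ∫ x in D.s i..D.s (i + 1), 4 * c ^ 2 * D.c i
      + (2 * c - 4 * c ^ 2 * D.c i) ^ 2 / (2 * c) * (1 + 2 * c * x)
      = 4 * c ^ 2 * D.c i * (D.s (i + 1) - D.s i) + (2 * c - 4 * c ^ 2 * D.c i) ^ 2 / (2 * c)
            * (D.s (i + 1) - D.s i + c * (D.s (i + 1) ^ 2 - D.s i ^ 2)) := by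
    intro i
    rw [intervalIntegral.integral_add, intervalIntegral.integral_const,
      intervalIntegral.integral_const_mul, intervalIntegral.integral_add,
      intervalIntegral.integral_const, intervalIntegral.integral_const_mul, integral_id]
    · simp only [smul_eq_mul]; ring
    all_goals exact Continuous.intervalIntegrable (by fun_prop) _ _
  simp only [h2] at h1
  rw [h.coeff_two_eq_sum hR hc, ← h1, D.integral_υ]
  have h3 : ∫ x in (0:ℝ)..R, 4 * c ^ 2 * S.w x + (2 * c - 4 * c ^ 2 * S.w x) ^ 2 / (2 * c)
      * (1 + 2 * c * x) = 2 * c * R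
        - 4 * c ^ 2 * (∫ x in (0:ℝ)..R, (S.w x - x / (1 + 2 * c * x)))
        + 8 * c ^ 3 * ∫ x in (0:ℝ)..R, |S.w x - x / (1 + 2 * c * x)| ^ 2 * (1 + 2 * c * x) := by
    rw [← intervalIntegral.integral_const_mul, ← intervalIntegral.integral_const_mul]
    have e : ∫ x in (0:ℝ)..R, (2 * c) = 2 * c * R := by
      rw [intervalIntegral.integral_const, smul_eq_mul]; ring
    rw [← e, ← intervalIntegral.integral_sub (by simp) (hd'.const_mul _),
      ← intervalIntegral.integral_add ((by simp : IntervalIntegrable (fun _ => 2 * c) volume 0 R).sub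
        (hd'.const_mul _)) (hd2'.const_mul _)]
    refine intervalIntegral.integral_congr fun x hx => ?_
    rw [uIcc_of_le hR.le] at hx
    exact hpt x hx
  rw [h3]
  simp only [smul_eq_mul]
  ring

lemma IsPolyNodal.coeff_jostPoly (h : D.IsPolyNodal c F G) (hR : 0 < R) (hc : 0 < c) :
    (jostPoly c F G).coeff 0 = -(2 * c) ∧
    (jostPoly c F G).coeff 1 = 2 * c * (2 - (F 0).coeff 1) ∧
    (jostPoly c F G).coeff 2 = 2 * c * ((F 0).coeff 1 - (F 0).coeff 2) + (G 0).coeff 2 := by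
  obtain ⟨h1, h2, h3⟩ := h.coeff_low hR hc (Nat.zero_le D.n)
  have e : jostPoly c F G = C (2 * c) * (X * F 0 - F 0) + G 0 := by rw [jostPoly]; ring
  rw [e]
  simp only [coeff_add, coeff_C_mul, coeff_sub]
  refine ⟨?_, ?_, ?_⟩
  · rw [coeff_X_mul_zero, h1, h2]; ring
  · have k : (X * F 0).coeff 1 = (F 0).coeff 0 := coeff_X_mul (F 0) 0
    rw [k, h1, h3]; ring
  · have k : (X * F 0).coeff 2 = (F 0).coeff 1 := coeff_X_mul (F 0) 1
    rw [k]

end PieceData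

end JostTaylor

/-! ### Sums over the roots of a real polynomial. -/

section RootSums

open Polynomial Real Complex

lemma integral_kernel_line {k : ℝ → ℝ} {K : ℂ → ℝ} (hK : Continuous K)
    (hkK : ∀ θ ∈ Ioo 0 (2 * π),
      (1 + cayleyLine θ ^ 2) / 2 * k (cayleyLine θ) = K (circleMap 0 1 θ)) :
    Integrable k ∧ ∫ t, k t = 2 * π * Real.circleAverage K 0 1 := by
  have hKi : CircleIntegrable K 0 1 := hK.continuousOn.circleIntegrable'
  have hi : IntegrableOn (fun θ => K (circleMap 0 1 θ)) (Ioo 0 (2 * π)) := by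
    have : IntervalIntegrable (fun θ => K (circleMap 0 1 θ)) volume 0 (2 * π) := hKi
    rwa [intervalIntegrable_iff_integrableOn_Ioo_of_le (by positivity)] at this
  constructor
  · rw [integrable_iff_integrableOn_cayleyLine]
    exact (integrableOn_congr_fun hkK measurableSet_Ioo).2 hi
  · rw [integral_eq_integral_cayleyLine, setIntegral_congr_fun measurableSet_Ioo hkK,
      Real.circleAverage_def, smul_eq_mul, intervalIntegral.integral_of_le (by positivity),
      integral_Ioc_eq_integral_Ioo]
    field_simp

lemma circleAverage_one_sub_re_pow {n : ℕ} (hn : n ≠ 0) (d : ℝ) :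
    Real.circleAverage (fun w : ℂ => (1 - (w ^ n).re) / d) 0 1 = 1 / d := by
  have h1 := circleAverage_mul_one_sub_re_pow (fun _ => 1) (circleIntegrable_const _ _ _) n d
  simp only [one_mul] at h1
  rw [h1, Real.circleAverage_const, circleAverage_re_pow hn, sub_zero]

lemma integral_kernel :
    Integrable (fun t : ℝ => 1 / (1 + t ^ 2) ^ 2) ∧ ∫ t : ℝ, 1 / (1 + t ^ 2) ^ 2 = π / 2 := by
  have h := integral_kernel_line (k := fun t => 1 / (1 + t ^ 2) ^ 2)
    (K := fun w => (1 - (w ^ 1).re) / 4) (by fun_prop) fun θ hθ => by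
      simpa using kernel_cayleyLine hθ
  refine ⟨h.1, h.2.trans ?_⟩
  rw [circleAverage_one_sub_re_pow one_ne_zero]
  ring

lemma integral_kernel_sq :
    Integrable (fun t : ℝ => t ^ 2 / (1 + t ^ 2) ^ 3) ∧
      ∫ t : ℝ, t ^ 2 / (1 + t ^ 2) ^ 3 = π / 8 := by
  have h := integral_kernel_line (k := fun t => t ^ 2 / (1 + t ^ 2) ^ 3)
    (K := fun w => (1 - (w ^ 2).re) / 16) (by fun_prop) fun θ hθ => kernel_sq_cayleyLine hθ
  refine ⟨h.1, h.2.trans ?_⟩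
  rw [circleAverage_one_sub_re_pow two_ne_zero]
  ring

/-- The reflection of the half-plane `Re σ < 1 / 2` in its boundary. -/
noncomputable def halfReflect (ρ : ℂ) : ℂ := if ρ.re < 1 / 2 then 1 - starRingEnd ℂ ρ else ρ

lemma half_le_re_halfReflect (ρ : ℂ) : 1 / 2 ≤ (halfReflect ρ).re := by
  rw [halfReflect]
  split_ifs with h
  · simp only [sub_re, one_re, conj_re]; linarith
  · exact not_lt.1 h

lemma norm_line_sub_halfReflect (ρ : ℂ) (t : ℝ) :
    ‖(1 + I * t) / 2 - halfReflect ρ‖ = ‖(1 + I * t) / 2 - ρ‖ := by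
  rw [halfReflect]
  split_ifs with h
  · have : (1 + I * t) / 2 - (1 - starRingEnd ℂ ρ) = -starRingEnd ℂ ((1 + I * t) / 2 - ρ) := by
      simp only [map_sub, map_div₀, map_add, map_one, map_mul, conj_I, conj_ofReal, map_ofNat]
      ring
    rw [this, norm_neg, RCLike.norm_conj]
  · rfl

lemma integral_log_norm_multiset {k : ℝ → ℝ} {V : ℂ → ℝ}
    (hV : ∀ ρ : ℂ, 1 / 2 ≤ ρ.re →
      Integrable (fun t : ℝ => k t * Real.log ‖(1 + I * t) / 2 - ρ‖) ∧
      ∫ t : ℝ, k t * Real.log ‖(1 + I * t) / 2 - ρ‖ = V ρ) (M : Multiset ℂ) :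
    Integrable (fun t : ℝ => k t * (M.map fun ρ => Real.log ‖(1 + I * t) / 2 - ρ‖).sum) ∧
    ∫ t : ℝ, k t * (M.map fun ρ => Real.log ‖(1 + I * t) / 2 - ρ‖).sum
      = (M.map fun ρ => V (halfReflect ρ)).sum := by
  induction M using Multiset.induction_on with
  | empty => simp
  | cons ρ M ih =>
    have h1 := hV _ (half_le_re_halfReflect ρ)
    simp only [norm_line_sub_halfReflect] at h1
    simp only [Multiset.map_cons, Multiset.sum_cons, mul_add]
    exact ⟨h1.1.add ih.1, by rw [integral_add h1.1 ih.1, h1.2, ih.2]⟩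

lemma aeval_eq_prod_roots (Q : ℝ[X]) (σ : ℂ) :
    aeval σ Q = Q.leadingCoeff * ((Q.aroots ℂ).map fun ρ => σ - ρ).prod := by
  have h := (IsAlgClosed.splits (Q.map (algebraMap ℝ ℂ))).eq_prod_roots
  have h2 := congrArg (eval σ) h
  rw [eval_map_algebraMap, eval_mul, eval_C, eval_multiset_prod, Multiset.map_map,
    leadingCoeff_map] at h2
  simpa [aroots_def] using h2

lemma log_norm_aeval {Q : ℝ[X]} {σ : ℂ} (h : aeval σ Q ≠ 0) :
    Real.log ‖aeval σ Q‖ = Real.log |Q.leadingCoeff|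
      + ((Q.aroots ℂ).map fun ρ => Real.log ‖σ - ρ‖).sum := by
  have key : ∀ M : Multiset ℂ, (M.map fun ρ => σ - ρ).prod ≠ 0 →
      Real.log ‖(M.map fun ρ => σ - ρ).prod‖ = (M.map fun ρ => Real.log ‖σ - ρ‖).sum := by
    intro M
    induction M using Multiset.induction_on with
    | empty => simp
    | cons ρ M ih =>
      intro hM
      rw [Multiset.map_cons, Multiset.prod_cons] at hM
      rw [Multiset.map_cons, Multiset.prod_cons, Multiset.map_cons, Multiset.sum_cons, norm_mul,
        Real.log_mul (norm_ne_zero_iff.2 (left_ne_zero_of_mul hM))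
          (norm_ne_zero_iff.2 (right_ne_zero_of_mul hM)), ih (right_ne_zero_of_mul hM)]
  rw [aeval_eq_prod_roots] at h ⊢
  rw [norm_mul, Real.log_mul (norm_ne_zero_iff.2 (left_ne_zero_of_mul h))
    (norm_ne_zero_iff.2 (right_ne_zero_of_mul h)), key _ (right_ne_zero_of_mul h),
    Complex.norm_real, Real.norm_eq_abs]

lemma coeff_prod_X_sub_C (M : Multiset ℂ) (hM : ∀ ρ ∈ M, ρ ≠ 0) :
    (M.map fun ρ => X - C ρ).prod.coeff 1
      = -(M.map fun ρ => X - C ρ).prod.coeff 0 * (M.map fun ρ => ρ⁻¹).sum ∧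
    (M.map fun ρ => X - C ρ).prod.coeff 2
      = (M.map fun ρ => X - C ρ).prod.coeff 0 *
        ((M.map fun ρ => ρ⁻¹).sum ^ 2 - (M.map fun ρ => ρ⁻¹ ^ 2).sum) / 2 := by
  induction M using Multiset.induction_on with
  | empty => simp [coeff_one]
  | cons ρ M ih =>
    have hρ : ρ ≠ 0 := hM ρ (Multiset.mem_cons_self ρ M)
    obtain ⟨h1, h2⟩ := ih fun x hx => hM x (Multiset.mem_cons_of_mem hx)
    simp only [Multiset.map_cons, Multiset.prod_cons, Multiset.sum_cons]
    generalize (M.map fun ρ => X - C ρ).prod = P at h1 h2 ⊢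
    have e : (X - C ρ) * P = X * P - C ρ * P := by ring
    have k1 : (X * P).coeff 1 = P.coeff 0 := coeff_X_mul P 0
    have k2 : (X * P).coeff 2 = P.coeff 1 := coeff_X_mul P 1
    rw [e]
    simp only [coeff_sub, coeff_C_mul, coeff_X_mul_zero, k1, k2]
    rw [h2, h1]
    constructor
    · field_simp; ring
    · field_simp; ring

/-- Newton's identities for Q = Q(0) ∏ (1 - σ/ρ). -/
lemma coeff_eq_sum_inv_roots {Q : ℝ[X]} (h0 : Q.coeff 0 ≠ 0) :
    (Q.coeff 1 : ℂ) = -Q.coeff 0 * ((Q.aroots ℂ).map fun ρ => ρ⁻¹).sum ∧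
    (Q.coeff 2 : ℂ) = Q.coeff 0 * (((Q.aroots ℂ).map fun ρ => ρ⁻¹).sum ^ 2
      - ((Q.aroots ℂ).map fun ρ => ρ⁻¹ ^ 2).sum) / 2 := by
  have h := (IsAlgClosed.splits (Q.map (algebraMap ℝ ℂ))).eq_prod_roots
  have hne : ∀ ρ ∈ Q.aroots ℂ, ρ ≠ 0 := by
    rintro ρ hρ rfl
    have := (mem_aroots.1 hρ).2
    rw [← coeff_zero_eq_aeval_zero'] at this
    exact h0 (by simpa using this)
  have hc : ∀ n, (Q.coeff n : ℂ) = (Q.map (algebraMap ℝ ℂ)).leadingCoeff *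
      ((Q.aroots ℂ).map fun ρ => X - C ρ).prod.coeff n := by
    intro n
    have := congrArg (fun P => coeff P n) h
    simpa [aroots_def, coeff_C_mul] using this
  obtain ⟨h1, h2⟩ := coeff_prod_X_sub_C _ hne
  rw [hc 0, hc 1, hc 2, h1, h2]
  constructor <;> ring

lemma sum_halfReflect (M : Multiset ℂ) (g : ℂ → ℝ) :
    (M.map fun ρ => g (halfReflect ρ)).sum = (M.map g).sum
      + ((M.filter fun ρ => ρ.re < 1 / 2).map fun ρ => g (1 - starRingEnd ℂ ρ) - g ρ).sum := by
  induction M using Multiset.induction_on with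
  | empty => simp
  | cons ρ M ih =>
    by_cases h : ρ.re < 1 / 2
    · rw [Multiset.filter_cons_of_pos M h]
      simp only [Multiset.map_cons, Multiset.sum_cons, ih]
      rw [halfReflect, if_pos h]
      ring
    · rw [Multiset.filter_cons_of_neg M h]
      simp only [Multiset.map_cons, Multiset.sum_cons, ih]
      rw [halfReflect, if_neg h]
      ring

lemma re_multiset_sum_map (M : Multiset ℂ) (g : ℂ → ℂ) :
    (M.map g).sum.re = (M.map fun ρ => (g ρ).re).sum := by
  induction M using Multiset.induction_on with
  | empty => simp
  | cons ρ M ih => simp [ih]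

/-- Integration of `log |Q σ / (σ - 1/2)|` over the line `Re σ = 1/2`. -/
lemma integral_kernel_log_norm_poly {k : ℝ → ℝ} {V : ℂ → ℝ} {v : ℝ}
    (hk : Integrable k ∧ ∫ t, k t = v)
    (hV : ∀ ρ : ℂ, 1 / 2 ≤ ρ.re →
      Integrable (fun t : ℝ => k t * Real.log ‖(1 + I * t) / 2 - ρ‖) ∧
      ∫ t : ℝ, k t * Real.log ‖(1 + I * t) / 2 - ρ‖ = V ρ)
    {Q : ℝ[X]} (hQ : Q ≠ 0) {L : ℝ → ℝ} (C₀ : ℝ)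
    (hL : ∀ t : ℝ, t ≠ 0 → aeval ((1 + I * t) / 2) Q ≠ 0 →
      L t = C₀ + Real.log ‖aeval ((1 + I * t) / 2) Q‖ - Real.log ‖(1 + I * t) / 2 - 1 / 2‖) :
    Integrable (fun t => k t * L t) ∧ ∫ t, k t * L t = v * (C₀ + Real.log |Q.leadingCoeff|)
      + ((Q.aroots ℂ).map fun ρ => V (halfReflect ρ)).sum - V (1 / 2) := by
  have h1 := integral_log_norm_multiset hV (Q.aroots ℂ)
  have h2 := hV (1 / 2) (by norm_num)
  have h3 := hk.1.mul_const (C₀ + Real.log |Q.leadingCoeff|)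
  have hae : ∀ᵐ t : ℝ, k t * (C₀ + Real.log |Q.leadingCoeff|)
      + k t * ((Q.aroots ℂ).map fun ρ => Real.log ‖(1 + I * t) / 2 - ρ‖).sum
      - k t * Real.log ‖(1 + I * t) / 2 - 1 / 2‖ = k t * L t := by
    -- The exceptional set is finite, so the zeros of Q on the line and the possible pole of `a` at
    -- k = 0 do not matter for the integral.
    have hfin : {t : ℝ | t = 0 ∨ aeval ((1 + I * t) / 2 : ℂ) Q = 0}.Finite := by
      refine (finite_singleton (0:ℝ)).union ?_
      have hinj : Function.Injective fun t : ℝ => (1 + I * t) / 2 := by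
        intro s t hst
        have := congrArg Complex.im hst
        simpa using this
      refine ((Q.aroots ℂ).toFinset.finite_toSet.preimage hinj.injOn).subset fun t ht => ?_
      simp only [Set.mem_preimage, Finset.mem_coe, Multiset.mem_toFinset]
      exact mem_aroots.2 ⟨hQ, ht⟩
    filter_upwards [measure_eq_zero_iff_ae_notMem.1 (hfin.measure_zero volume)] with t ht
    simp only [not_or] at ht
    rw [hL t ht.1 ht.2, log_norm_aeval ht.2]
    ring
  have h4 : Integrable fun t : ℝ => k t * (C₀ + Real.log |Q.leadingCoeff|)
      + k t * ((Q.aroots ℂ).map fun ρ => Real.log ‖(1 + I * t) / 2 - ρ‖).sum := h3.add h1.1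
  refine ⟨(h4.sub h2.1).congr hae, ?_⟩
  rw [← integral_congr_ae hae, integral_sub h4 h2.1, integral_add h3 h1.1, h1.2, h2.2,
    integral_mul_const, hk.2]

end RootSums

/-! ### The function a(k), its uniqueness and its zeros. -/

section JostFunction

open Polynomial Complex

/-- The exponent `i k / (2 c) + 1 / 2`. -/
noncomputable def jostExponent (c : ℝ) (k : ℂ) : ℂ := I * k / (2 * c) + 1 / 2

/-- The function `(1 + 2 c R) ^ σ * Q σ / (2 i k)` with `σ = i k / (2 c) + 1 / 2`. -/
noncomputable def jostFunction (c R : ℝ) (Q : ℝ[X]) (k : ℂ) : ℂ :=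
  jostTail c (jostExponent c k) R * aeval (jostExponent c k) Q / (2 * I * k)

variable {c : ℝ}

lemma re_jostExponent (c : ℝ) (k : ℂ) : (jostExponent c k).re = 1 / 2 - k.im / (2 * c) := by
  have : jostExponent c k = I * k / ((2 * c : ℝ) : ℂ) + ((1 / 2 : ℝ) : ℂ) := by
    rw [jostExponent]; push_cast; ring
  rw [this, add_re, div_ofReal_re, ofReal_re, I_mul_re]
  ring

lemma jostExponent_param (hc : 0 < c) (k : ℂ) :
    4 * (c : ℂ) ^ 2 * (jostExponent c k - jostExponent c k ^ 2) = k ^ 2 + (c : ℂ) ^ 2 := by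
  have hcC : (c : ℂ) ≠ 0 := by exact_mod_cast hc.ne'
  rw [jostExponent]
  field_simp
  linear_combination -4 * k ^ 2 * I_sq

lemma two_mul_jostExponent_sub_one (hc : 0 < c) (k : ℂ) :
    2 * (c : ℂ) * (jostExponent c k - 1) = I * k - c := by
  have hcC : (c : ℂ) ≠ 0 := by exact_mod_cast hc.ne'
  rw [jostExponent]
  field_simp
  ring

lemma differentiable_jostExponent (c : ℝ) : Differentiable ℂ (jostExponent c) := by
  unfold jostExponent
  fun_prop

lemma analyticOnNhd_jostFunction (c R : ℝ) (Q : ℝ[X]) :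
    AnalyticOnNhd ℂ (jostFunction c R Q) {0}ᶜ := by
  refine DifferentiableOn.analyticOnNhd ?_ isOpen_compl_singleton
  have h1 : Differentiable ℂ fun k => jostTail c (jostExponent c k) R := by
    unfold jostTail
    have := differentiable_jostExponent c
    fun_prop
  have h2 : Differentiable ℂ fun k => aeval (jostExponent c k) Q :=
    Differentiable.comp (g := fun x : ℂ => aeval x Q) (Polynomial.differentiable_aeval Q)
      (differentiable_jostExponent c)
  refine ((h1.mul h2).differentiableOn).div (by fun_prop) fun k hk => ?_
  simpa using hk

lemma jostTail_ne_zero (c : ℝ) (σ : ℂ) (x : ℝ) : jostTail c σ x ≠ 0 := Complex.exp_ne_zero _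

namespace PieceData

variable {S : HalfLineString} {α R : ℝ} {D : PieceData S R} {F G : ℕ → ℝ[X]}

lemma sqrt_ofReal_sq (hα : 0 < α) : ((√α : ℝ) : ℂ) ^ 2 = α := by
  rw [← ofReal_pow, Real.sq_sqrt hα.le]

lemma isJostSolution_iff (hα : 0 < α) (hR : 0 < R) {k : ℂ} {f : ℝ → ℂ} {d : ℂ} :
    S.IsJostSolution α R k f d ↔
      S.IsSolution (4 * ((√α : ℝ) : ℂ) ^ 2 * (jostExponent √α k - jostExponent √α k ^ 2)) f d ∧
        ∀ x, R ≤ x → f x = jostTail √α (jostExponent √α k) x := by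
  have hc : 0 < √α := Real.sqrt_pos.2 hα
  rw [jostExponent_param hc, sqrt_ofReal_sq hα, HalfLineString.IsJostSolution]
  refine and_congr_right fun _ => forall₂_congr fun x hx => ?_
  rw [jostTail_eq_cpow (one_add_mul_pos hc (hR.le.trans hx)), jostExponent]

lemma IsPolyNodal.isJostFunction (h : D.IsPolyNodal √α F G) (hα : 0 < α)
    (hS : S.MemClassF α R) : S.IsJostFunction α R (jostFunction √α R (jostPoly √α F G)) := by
  have hc : 0 < √α := Real.sqrt_pos.2 hα
  refine ⟨analyticOnNhd_jostFunction _ _ _, fun k _ => ?_, fun k _ f d hf => ?_⟩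
  · obtain ⟨u, d, h1, h2, -⟩ := h.exists_solution hc hS.R_pos hS.w_eq (jostExponent √α k)
    exact ⟨u, d, (isJostSolution_iff hα hS.R_pos).2 ⟨h1, h2⟩⟩
  · obtain ⟨h1, h2⟩ := (isJostSolution_iff hα hS.R_pos).1 hf
    have := h.solution_value hc hS.R_pos hS.w_eq h1 h2
    rw [two_mul_jostExponent_sub_one hc] at this
    rw [jostFunction, ← this]
    ring

end PieceData

/-- The identity theorem, since the punctured plane is connected. Every admissible `a` is thereby
given by the explicit formula. -/
lemma HalfLineString.IsJostFunction.eqOn {S : HalfLineString} {α R : ℝ} {a b : ℂ → ℂ}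
    (ha : S.IsJostFunction α R a) (hb : S.IsJostFunction α R b) : EqOn a b {0}ᶜ := by
  have hconn : IsPreconnected ({0}ᶜ : Set ℂ) :=
    (isConnected_compl_singleton_of_one_lt_rank (by simp) 0).isPreconnected
  refine ha.analytic.eqOn_of_preconnected_of_eventuallyEq hb.analytic hconn (z₀ := I) (by simp) ?_
  have : {k : ℂ | 0 < k.im} ∈ nhds I :=
    (isOpen_lt continuous_const Complex.continuous_im).mem_nhds (by simp)
  filter_upwards [this] with k hk
  obtain ⟨f, d, hf⟩ := ha.exists_jost k hk
  rw [ha.eq_jost k hk f d hf, hb.eq_jost k hk f d hf]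

lemma jostExponent_sub (k k₀ : ℂ) :
    jostExponent c k - jostExponent c k₀ = I / (2 * c) * (k - k₀) := by
  rw [jostExponent, jostExponent]; ring

/-- The exponent is affine and nonconstant in k, and the remaining factors (1 + 2cR)^σ and 1/(2ik)
are analytic without zeros off 0, so orders are root multiplicities. -/
lemma analyticOrderAt_jostFunction (hc : 0 < c) {R : ℝ} {Q : ℝ[X]} (hQ : Q ≠ 0) {a : ℂ → ℂ}
    (ha : EqOn a (jostFunction c R Q) {0}ᶜ) (haa : AnalyticOnNhd ℂ a {0}ᶜ) {k₀ : ℂ}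
    (hk₀ : k₀ ≠ 0) :
    analyticOrderAt a k₀ = ((Q.aroots ℂ).count (jostExponent c k₀) : ℕ∞) := by
  have hcC : (c : ℂ) ≠ 0 := by exact_mod_cast hc.ne'
  have hQ' : Q.map (algebraMap ℝ ℂ) ≠ 0 := (Polynomial.map_ne_zero_iff (algebraMap ℝ ℂ).injective).2 hQ
  rw [aroots_def, count_roots]
  set m := rootMultiplicity (jostExponent c k₀) (Q.map (algebraMap ℝ ℂ))
  obtain ⟨P, hP, hPn⟩ := exists_eq_pow_rootMultiplicity_mul_and_not_dvd _ hQ' (jostExponent c k₀)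
  rw [(haa k₀ hk₀).analyticOrderAt_eq_natCast]
  refine ⟨fun k => jostTail c (jostExponent c k) R * ((I / (2 * c)) ^ m
    * P.eval (jostExponent c k)) / (2 * I * k), ?_, ?_, ?_⟩
  · have h1 : Differentiable ℂ fun k => jostTail c (jostExponent c k) R := by
      unfold jostTail
      have := differentiable_jostExponent c
      fun_prop
    have h2 : Differentiable ℂ fun k => P.eval (jostExponent c k) :=
      P.differentiable.comp (differentiable_jostExponent c)
    have h3 : DifferentiableOn ℂ (fun k => jostTail c (jostExponent c k) R * ((I / (2 * c)) ^ m
        * P.eval (jostExponent c k)) / (2 * I * k)) {0}ᶜ :=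
      ((h1.mul (h2.const_mul _)).differentiableOn).div (by fun_prop) fun k hk => by simpa using hk
    exact h3.analyticOnNhd isOpen_compl_singleton k₀ hk₀
  · have h1 : P.eval (jostExponent c k₀) ≠ 0 := fun h0 => hPn (dvd_iff_isRoot.2 h0)
    have h2 := jostTail_ne_zero c (jostExponent c k₀) R
    have hI := I_ne_zero
    simp only [ne_eq, div_eq_zero_iff, mul_eq_zero, not_or]
    refine ⟨⟨h2, pow_ne_zero _ (div_ne_zero hI (by simpa using hcC)), h1⟩, ⟨by simp, hk₀⟩⟩
  · filter_upwards [isOpen_compl_singleton.mem_nhds (show k₀ ∈ ({0}ᶜ : Set ℂ) from hk₀)] with k hk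
    have e : aeval (jostExponent c k) Q
        = (jostExponent c k - jostExponent c k₀) ^ m * P.eval (jostExponent c k) := by
      rw [← eval_map_algebraMap, hP]
      simp [m]
    rw [ha hk, jostFunction, e, jostExponent_sub, mul_pow, smul_eq_mul]
    ring

/-- The zeros of the Jost function in the upper half-plane in terms of the variable `σ`. -/
lemma isUpperZeroEnumeration_iff (hc : 0 < c) {R : ℝ} {Q : ℝ[X]} (hQ : Q ≠ 0) {a : ℂ → ℂ}
    (ha : EqOn a (jostFunction c R Q) {0}ᶜ) (haa : AnalyticOnNhd ℂ a {0}ᶜ) {N : ℕ}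
    (κ : Fin N → ℝ) :
    IsUpperZeroEnumeration a κ ↔ (∀ n, 0 < κ n) ∧
      (Finset.univ.val.map fun n => (((c - κ n) / (2 * c) : ℝ) : ℂ))
        = (Q.aroots ℂ).filter fun ρ => ρ.re < 1 / 2 := by
  classical
  have hcC : (c : ℂ) ≠ 0 := by exact_mod_cast hc.ne'
  have hI := I_ne_zero
  -- The point k = ic(1 - 2ρ) is the preimage of ρ under the affine map k ↦ σ.
  have hinv : ∀ ρ : ℂ, jostExponent c (I * c * (1 - 2 * ρ)) = ρ := by
    intro ρ
    rw [jostExponent]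
    field_simp
    linear_combination (1 - 2 * ρ) * I_sq
  have hiff : ∀ (k : ℂ) (x : ℝ), I * (x : ℂ) = k ↔
      jostExponent c k = (((c - x) / (2 * c) : ℝ) : ℂ) := by
    intro k x
    rw [jostExponent]
    push_cast
    have e : I * k / (2 * c) + 1 / 2 - (c - x) / (2 * c) = I * (k - I * x) / (2 * c) := by
      field_simp
      linear_combination x * I_sq
    rw [← sub_eq_zero (b := ((c - x) / (2 * c) : ℂ)), e]
    simp only [div_eq_zero_iff, mul_eq_zero, hI, false_or]
    constructor
    · rintro rfl; simp
    · rintro (h | h | h)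
      · exact (sub_eq_zero.1 h).symm
      · norm_num at h
      · exact absurd h hcC
  have hcount : ∀ k : ℂ, Nat.card {n : Fin N // I * (κ n : ℂ) = k}
      = (Finset.univ.val.map fun n => (((c - κ n) / (2 * c) : ℝ) : ℂ)).count
        (jostExponent c k) := by
    intro k
    rw [Multiset.count_map, Nat.card_eq_fintype_card, Fintype.card_subtype, Finset.card_def,
      Finset.filter_val]
    congr 2
    funext n
    exact propext (hiff k (κ n))
  refine and_congr_right fun hκ => ⟨fun h => ?_, fun h k hk => ?_⟩
  · ext ρ
    rw [Multiset.count_filter]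
    split_ifs with hρ
    · have hk : 0 < (I * c * (1 - 2 * ρ)).im := by
        have : I * c * (1 - 2 * ρ) = I * ((c : ℂ) * (1 - 2 * ρ)) := by ring
        rw [this, I_mul_im, re_ofReal_mul]
        simp only [sub_re, one_re, mul_re, re_ofNat, im_ofNat, zero_mul, sub_zero]
        have : 0 < 1 - 2 * ρ.re := by linarith
        positivity
      have hk0 : I * c * (1 - 2 * ρ) ≠ 0 := by
        intro h0; rw [h0] at hk; simp at hk
      have h1 := h _ hk
      rw [analyticOrderAt_jostFunction hc hQ ha haa hk0, hcount, hinv] at h1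
      exact_mod_cast h1.symm
    · rw [Multiset.count_eq_zero, Multiset.mem_map]
      rintro ⟨n, -, rfl⟩
      apply hρ
      rw [ofReal_re, div_lt_div_iff₀ (by positivity) (by norm_num)]
      linarith [hκ n]
  · have hk0 : k ≠ 0 := by rintro rfl; simp at hk
    rw [analyticOrderAt_jostFunction hc hQ ha haa hk0, hcount, h, Multiset.count_filter, if_pos]
    rw [re_jostExponent c]
    have : 0 < k.im / (2 * c) := by positivity
    linarith

lemma exists_isUpperZeroEnumeration (hc : 0 < c) {R : ℝ} {Q : ℝ[X]} (hQ : Q ≠ 0) {a : ℂ → ℂ}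
    (ha : EqOn a (jostFunction c R Q) {0}ᶜ) (haa : AnalyticOnNhd ℂ a {0}ᶜ)
    (him : ∀ σ : ℂ, σ.re < 1 / 2 → aeval σ Q = 0 → σ.im = 0) :
    ∃ (N : ℕ) (κ : Fin N → ℝ), IsUpperZeroEnumeration a κ := by
  classical
  set M := (Q.aroots ℂ).filter fun ρ => ρ.re < 1 / 2 with hM
  have hmem : ∀ ρ ∈ M, ρ.re < 1 / 2 ∧ ρ.im = 0 := by
    intro ρ hρ
    obtain ⟨h1, h2⟩ := Multiset.mem_filter.1 hρ
    exact ⟨h2, him ρ h2 (mem_aroots.1 h1).2⟩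
  obtain ⟨l, hl⟩ : ∃ l : List ℂ, (l : Multiset ℂ) = M := ⟨M.toList, M.coe_toList⟩
  refine ⟨l.length, fun n => c * (1 - 2 * (l.get n).re), ?_⟩
  have hget : ∀ n, l.get n ∈ M := fun n => by rw [← hl]; exact List.get_mem l n
  rw [isUpperZeroEnumeration_iff hc hQ ha haa]
  refine ⟨fun n => ?_, ?_⟩
  · have := (hmem _ (hget n)).1
    have : 0 < 1 - 2 * (l.get n).re := by linarith
    positivity
  · rw [← hM, ← hl]
    have e : (fun n : Fin l.length => (((c - c * (1 - 2 * (l.get n).re)) / (2 * c) : ℝ) : ℂ))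
        = l.get := by
      funext n
      have h2 := (hmem _ (hget n)).2
      have h3 : (c - c * (1 - 2 * (l.get n).re)) / (2 * c) = (l.get n).re := by
        field_simp; ring
      rw [h3]
      exact Complex.ext (by simp) (by rw [ofReal_im, h2])
    rw [e, Fin.univ_val_map]
    simp [List.ofFn_get]

end JostFunction

/-! ### Assembly of the trace formulas. -/

section TraceFormulas

open Polynomial Complex

lemma log_norm_jostFunction {c R : ℝ} (hc : 0 < c) {Q : ℝ[X]} {a : ℂ → ℂ}
    (ha : EqOn a (jostFunction c R Q) {0}ᶜ) {t : ℝ} (ht : t ≠ 0)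
    (hQt : aeval ((1 + I * t) / 2 : ℂ) Q ≠ 0) :
    Real.log ‖a (c * t : ℝ)‖ = Real.log (1 + 2 * c * R) / 2 - Real.log (4 * c)
      + Real.log ‖aeval ((1 + I * t) / 2 : ℂ) Q‖ - Real.log ‖(1 + I * t) / 2 - 1 / 2‖ := by
  have hcC : (c : ℂ) ≠ 0 := by exact_mod_cast hc.ne'
  have htC : (t : ℂ) ≠ 0 := by exact_mod_cast ht
  have hne : ((c * t : ℝ) : ℂ) ≠ 0 := by push_cast; exact mul_ne_zero hcC htC
  have hexp : jostExponent c ((c * t : ℝ) : ℂ) = (1 + I * t) / 2 := by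
    rw [jostExponent]; push_cast; field_simp; ring
  have hden : 2 * I * ((c * t : ℝ) : ℂ) = ((4 * c : ℝ) : ℂ) * ((1 + I * t) / 2 - 1 / 2) := by
    push_cast; ring
  have hnum : Real.log ‖jostTail c ((1 + I * t) / 2) R‖ = Real.log (1 + 2 * c * R) / 2 := by
    rw [jostTail, Complex.norm_exp, Real.log_exp, re_mul_ofReal]
    have : ((1 + I * (t : ℂ)) / 2).re = 1 / 2 := by
      have e : (1 + I * (t : ℂ)) / 2 = (1 + I * t) / ((2 : ℝ) : ℂ) := by push_cast; rfl
      rw [e, div_ofReal_re]; simp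
    rw [this]; ring
  have h1 : ‖jostTail c ((1 + I * t) / 2) R‖ ≠ 0 := norm_ne_zero_iff.2 (jostTail_ne_zero _ _ _)
  have h2 : ‖aeval ((1 + I * t) / 2 : ℂ) Q‖ ≠ 0 := norm_ne_zero_iff.2 hQt
  have h3 : (1 + I * (t : ℂ)) / 2 - 1 / 2 ≠ 0 := by
    have e : (1 + I * (t : ℂ)) / 2 - 1 / 2 = I * t / 2 := by ring
    rw [e]
    exact div_ne_zero (mul_ne_zero I_ne_zero htC) two_ne_zero
  have h4 : ‖((4 * c : ℝ) : ℂ)‖ = 4 * c := by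
    rw [Complex.norm_real, Real.norm_of_nonneg (by positivity)]
  rw [ha (by simpa using hne), jostFunction, hexp, hden, norm_div, norm_mul, norm_mul, h4,
    Real.log_div (mul_ne_zero h1 h2) (mul_ne_zero (by positivity) (norm_ne_zero_iff.2 h3)),
    Real.log_mul h1 h2, Real.log_mul (by positivity) (norm_ne_zero_iff.2 h3), hnum]
  ring

lemma integral_scale {c : ℝ} (hc : 0 < c) {g h : ℝ → ℝ} {d A : ℝ}
    (hgh : ∀ t, g (c * t) = d * h t) (hh : Integrable h ∧ ∫ t, h t = A) :
    Integrable g ∧ ∫ k, g k = c * d * A := by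
  have h1 : Integrable fun t => g (c * t) := by
    simp only [hgh]
    exact hh.1.const_mul d
  refine ⟨(integrable_comp_mul_left_iff g hc.ne').1 h1, ?_⟩
  have h2 := Measure.integral_comp_mul_left g c
  simp only [hgh, integral_const_mul, hh.2, smul_eq_mul, abs_inv, abs_of_pos hc] at h2
  rw [mul_assoc, h2]
  field_simp

lemma log_norm_ratio {c κ : ℝ} (hc : 0 < c) (hκ : 0 < κ) (hne : κ ≠ c) :
    Real.log |(c + κ) / (2 * c)| - Real.log |(c - κ) / (2 * c)|
      = -Real.log |(κ - c) / (κ + c)| := by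
  have h1 : κ - c ≠ 0 := sub_ne_zero.2 hne
  have h2 : c - κ ≠ 0 := sub_ne_zero.2 hne.symm
  have h3 : κ + c ≠ 0 := by positivity
  rw [Real.log_abs, Real.log_abs, Real.log_abs, Real.log_div (by positivity) (by positivity),
    Real.log_div h2 (by positivity), Real.log_div h1 h3, ← Real.log_neg_eq_log (κ - c), neg_sub,
    add_comm c κ]
  ring_nf

variable {c : ℝ} {N : ℕ} {κ : Fin N → ℝ} {Q : ℝ[X]}

lemma sum_filter_roots
    (hκQ : (Finset.univ.val.map fun n => (((c - κ n) / (2 * c) : ℝ) : ℂ))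
      = (Q.aroots ℂ).filter fun ρ => ρ.re < 1 / 2) (hc : 0 < c) (V : ℂ → ℝ) :
    (((Q.aroots ℂ).filter fun ρ => ρ.re < 1 / 2).map
        fun ρ => V (1 - starRingEnd ℂ ρ) - V ρ).sum
      = ∑ n, (V (((c + κ n) / (2 * c) : ℝ) : ℂ) - V (((c - κ n) / (2 * c) : ℝ) : ℂ)) := by
  rw [← hκQ, Multiset.map_map, Finset.sum]
  congr 1
  refine Multiset.map_congr rfl fun n _ => ?_
  simp only [Function.comp]
  have : (1 : ℂ) - starRingEnd ℂ (((c - κ n) / (2 * c) : ℝ) : ℂ)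
      = (((c + κ n) / (2 * c) : ℝ) : ℂ) := by
    rw [conj_ofReal, ← ofReal_one, ← ofReal_sub]
    congr 1
    field_simp
    ring
  rw [this]

lemma ne_of_roots (hQ0 : Q.coeff 0 ≠ 0)
    (hκQ : (Finset.univ.val.map fun n => (((c - κ n) / (2 * c) : ℝ) : ℂ))
      = (Q.aroots ℂ).filter fun ρ => ρ.re < 1 / 2) (n : Fin N) : κ n ≠ c := by
  intro h
  have h1 : (((c - κ n) / (2 * c) : ℝ) : ℂ) ∈ (Q.aroots ℂ).filter fun ρ => ρ.re < 1 / 2 := by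
    rw [← hκQ]
    exact Multiset.mem_map_of_mem (f := fun n => (((c - κ n) / (2 * c) : ℝ) : ℂ))
      (Finset.mem_univ_val n)
  have h2 := (mem_aroots.1 (Multiset.mem_filter.1 h1).1).2
  rw [h, sub_self, zero_div, ofReal_zero, ← coeff_zero_eq_aeval_zero'] at h2
  exact hQ0 (by simpa using h2)

/-- The factorization of Q evaluated at σ = 0, where |Q(0)| = 2c. -/
lemma sum_log_norm_roots (hc : 0 < c) (hQ0 : Q.coeff 0 = -(2 * c)) :
    Real.log |Q.leadingCoeff| + ((Q.aroots ℂ).map fun ρ => Real.log ‖ρ‖).sum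
      = Real.log (2 * c) := by
  have h0 : aeval (0 : ℂ) Q = ((-(2 * c) : ℝ) : ℂ) := by
    rw [← coeff_zero_eq_aeval_zero', hQ0]; rfl
  have hne : aeval (0 : ℂ) Q ≠ 0 := by
    rw [h0]; exact_mod_cast (by simp [hc.ne'] : -(2 * c) ≠ 0)
  have := log_norm_aeval hne
  simp only [zero_sub, norm_neg] at this
  rw [← this, h0, Complex.norm_real, Real.norm_eq_abs, abs_neg, abs_of_pos (by positivity)]

/-- Identifies the parameters x and y as the power sums of the reciprocal roots. These are real
because the coefficients are. -/
lemma sum_inv_roots (hc : 0 < c) (hQ0 : Q.coeff 0 = -(2 * c)) {x y : ℝ}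
    (hQ1 : Q.coeff 1 = 2 * c * x) (hQ2 : Q.coeff 2 = c * (y - x ^ 2)) :
    ((Q.aroots ℂ).map fun ρ => (ρ⁻¹).re).sum = x ∧
      ((Q.aroots ℂ).map fun ρ => (ρ⁻¹ ^ 2).re).sum = y := by
  have hcC : (c : ℂ) ≠ 0 := by exact_mod_cast hc.ne'
  obtain ⟨h1, h2⟩ := coeff_eq_sum_inv_roots (Q := Q) (by rw [hQ0]; simp [hc.ne'])
  rw [hQ0, hQ1] at h1
  rw [hQ0, hQ2] at h2
  have e1 : ((Q.aroots ℂ).map fun ρ => ρ⁻¹).sum = (x : ℂ) := by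
    have : (2 * c : ℂ) * ((Q.aroots ℂ).map fun ρ => ρ⁻¹).sum = 2 * c * x := by
      push_cast at h1; linear_combination -h1
    exact mul_left_cancel₀ (by simpa using hcC) this
  rw [e1] at h2
  have e2 : ((Q.aroots ℂ).map fun ρ => ρ⁻¹ ^ 2).sum = (y : ℂ) := by
    have : (c : ℂ) * ((Q.aroots ℂ).map fun ρ => ρ⁻¹ ^ 2).sum = c * y := by
      push_cast at h2; linear_combination -h2
    exact mul_left_cancel₀ hcC this
  rw [← re_multiset_sum_map _ fun ρ => ρ⁻¹, ← re_multiset_sum_map _ fun ρ => ρ⁻¹ ^ 2, e1, e2]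
  exact ⟨ofReal_re _, ofReal_re _⟩

lemma first_kernel_integral (hc : 0 < c) (hκ : ∀ n, 0 < κ n)
    (hκQ : (Finset.univ.val.map fun n => (((c - κ n) / (2 * c) : ℝ) : ℂ))
      = (Q.aroots ℂ).filter fun ρ => ρ.re < 1 / 2)
    (hQ0 : Q.coeff 0 = -(2 * c)) {x y ℓ : ℝ} (hQ1 : Q.coeff 1 = 2 * c * x)
    (hQ2 : Q.coeff 2 = c * (y - x ^ 2)) {L : ℝ → ℝ}
    (hL : ∀ t : ℝ, t ≠ 0 → aeval ((1 + I * t) / 2 : ℂ) Q ≠ 0 →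
      L t = (ℓ / 2 - Real.log (4 * c)) + Real.log ‖aeval ((1 + I * t) / 2 : ℂ) Q‖
        - Real.log ‖(1 + I * t) / 2 - 1 / 2‖) :
    Integrable (fun t => 1 / (1 + t ^ 2) ^ 2 * L t) ∧
    ∫ t, 1 / (1 + t ^ 2) ^ 2 * L t = Real.pi * (ℓ / 4 + (2 - x) / 4
      - (∑ n, Real.log |(κ n - c) / (κ n + c)|) / 2 - c * ∑ n, κ n / (κ n ^ 2 - c ^ 2)) := by
  have hQ0' : Q.coeff 0 ≠ 0 := by rw [hQ0]; simp [hc.ne']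
  have hQ : Q ≠ 0 := by rintro rfl; simp at hQ0'
  have hne := ne_of_roots hQ0' hκQ
  obtain ⟨s1, s2⟩ := sum_inv_roots hc hQ0 hQ1 hQ2
  set V : ℂ → ℝ := fun ρ => Real.pi * (Real.log ‖ρ‖ / 2 - (ρ⁻¹).re / 4) with hV
  have h := integral_kernel_log_norm_poly integral_kernel (V := V)
    (fun ρ hρ => integral_kernel_log_norm_line hρ) hQ _ hL
  refine ⟨h.1, h.2.trans ?_⟩
  rw [sum_halfReflect, sum_filter_roots hκQ hc]
  have e1 : ((Q.aroots ℂ).map V).sum = Real.pi * ((((Q.aroots ℂ).map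
      fun ρ => Real.log ‖ρ‖).sum) / 2 - x / 4) := by
    rw [← s1, hV, Multiset.sum_map_mul_left, Multiset.sum_map_sub, Multiset.sum_map_div,
      Multiset.sum_map_div]
  -- The correction for reflecting the root (c - κ)/(2c) to (c + κ)/(2c).
  have e2 : ∑ n, (V (((c + κ n) / (2 * c) : ℝ) : ℂ) - V (((c - κ n) / (2 * c) : ℝ) : ℂ))
      = Real.pi * (-(∑ n, Real.log |(κ n - c) / (κ n + c)|) / 2
        - c * ∑ n, κ n / (κ n ^ 2 - c ^ 2)) := by
    rw [← Finset.sum_neg_distrib, Finset.sum_div, Finset.mul_sum, ← Finset.sum_sub_distrib,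
      Finset.mul_sum]
    refine Finset.sum_congr rfl fun n _ => ?_
    have h1 := log_norm_ratio hc (hκ n) (hne n)
    have h2 : κ n - c ≠ 0 := sub_ne_zero.2 (hne n)
    have h3 : c - κ n ≠ 0 := sub_ne_zero.2 (hne n).symm
    have h4 : c + κ n ≠ 0 := by have := hκ n; positivity
    have h5 : κ n ^ 2 - c ^ 2 ≠ 0 := by
      have : κ n ^ 2 - c ^ 2 = (κ n - c) * (c + κ n) := by ring
      rw [this]; exact mul_ne_zero h2 h4
    have h6 : ((c + κ n) / (2 * c))⁻¹ - ((c - κ n) / (2 * c))⁻¹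
        = 4 * (c * (κ n / (κ n ^ 2 - c ^ 2))) := by
      field_simp
      ring
    simp only [hV, ← ofReal_inv, ofReal_re, Complex.norm_real, Real.norm_eq_abs]
    linear_combination Real.pi * (h1 / 2 - h6 / 4)
  -- The contribution of the denominator 2ik = 4c(σ - 1/2).
  have e3 : V (1 / 2) = Real.pi * (-Real.log 2 / 2 - 1 / 2) := by
    simp only [hV]
    have hl : Real.log (1 / 2) = -Real.log 2 := by rw [one_div, Real.log_inv]
    norm_num [hl]
  have e4 := sum_log_norm_roots hc hQ0
  have e5 : Real.log (4 * c) = Real.log 2 + Real.log (2 * c) := by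
    rw [← Real.log_mul (by norm_num) (by positivity)]; congr 1; ring
  rw [e1, e2, e3, e5]
  linear_combination Real.pi / 2 * e4

lemma second_kernel_integral (hc : 0 < c) (hκ : ∀ n, 0 < κ n)
    (hκQ : (Finset.univ.val.map fun n => (((c - κ n) / (2 * c) : ℝ) : ℂ))
      = (Q.aroots ℂ).filter fun ρ => ρ.re < 1 / 2)
    (hQ0 : Q.coeff 0 = -(2 * c)) {x y ℓ : ℝ} (hQ1 : Q.coeff 1 = 2 * c * x)
    (hQ2 : Q.coeff 2 = c * (y - x ^ 2)) {L : ℝ → ℝ}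
    (hL : ∀ t : ℝ, t ≠ 0 → aeval ((1 + I * t) / 2 : ℂ) Q ≠ 0 →
      L t = (ℓ / 2 - Real.log (4 * c)) + Real.log ‖aeval ((1 + I * t) / 2 : ℂ) Q‖
        - Real.log ‖(1 + I * t) / 2 - 1 / 2‖) :
    Integrable (fun t => t ^ 2 / (1 + t ^ 2) ^ 3 * L t) ∧
    ∫ t, t ^ 2 / (1 + t ^ 2) ^ 3 * L t = Real.pi * (ℓ / 16 + (y - 2 * x) / 32
      - (∑ n, Real.log |(κ n - c) / (κ n + c)|) / 8
      - c / 4 * ∑ n, (κ n ^ 3 + c ^ 2 * κ n) / (κ n ^ 2 - c ^ 2) ^ 2) := by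
  have hQ0' : Q.coeff 0 ≠ 0 := by rw [hQ0]; simp [hc.ne']
  have hQ : Q ≠ 0 := by rintro rfl; simp at hQ0'
  have hne := ne_of_roots hQ0' hκQ
  obtain ⟨s1, s2⟩ := sum_inv_roots hc hQ0 hQ1 hQ2
  set V : ℂ → ℝ := fun ρ =>
    Real.pi * (Real.log ‖ρ‖ / 8 + (-2 * (ρ⁻¹).re + (ρ⁻¹ ^ 2).re) / 32) with hV
  have h := integral_kernel_log_norm_poly integral_kernel_sq (V := V)
    (fun ρ hρ => integral_kernel_sq_log_norm_line hρ) hQ _ hL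
  refine ⟨h.1, h.2.trans ?_⟩
  rw [sum_halfReflect, sum_filter_roots hκQ hc]
  have e1 : ((Q.aroots ℂ).map V).sum = Real.pi * ((((Q.aroots ℂ).map
      fun ρ => Real.log ‖ρ‖).sum) / 8 + (-2 * x + y) / 32) := by
    rw [← s1, ← s2, hV, Multiset.sum_map_mul_left, Multiset.sum_map_add, Multiset.sum_map_div,
      Multiset.sum_map_div, Multiset.sum_map_add, Multiset.sum_map_mul_left]
  have e2 : ∑ n, (V (((c + κ n) / (2 * c) : ℝ) : ℂ) - V (((c - κ n) / (2 * c) : ℝ) : ℂ))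
      = Real.pi * (-(∑ n, Real.log |(κ n - c) / (κ n + c)|) / 8
        - c / 4 * ∑ n, (κ n ^ 3 + c ^ 2 * κ n) / (κ n ^ 2 - c ^ 2) ^ 2) := by
    rw [← Finset.sum_neg_distrib, Finset.sum_div, Finset.mul_sum, ← Finset.sum_sub_distrib,
      Finset.mul_sum]
    refine Finset.sum_congr rfl fun n _ => ?_
    have h1 := log_norm_ratio hc (hκ n) (hne n)
    have h2 : κ n - c ≠ 0 := sub_ne_zero.2 (hne n)
    have h3 : c - κ n ≠ 0 := sub_ne_zero.2 (hne n).symm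
    have h4 : c + κ n ≠ 0 := by have := hκ n; positivity
    have h5 : κ n ^ 2 - c ^ 2 ≠ 0 := by
      have : κ n ^ 2 - c ^ 2 = (κ n - c) * (c + κ n) := by ring
      rw [this]; exact mul_ne_zero h2 h4
    have h6 : -2 * ((c + κ n) / (2 * c))⁻¹ + ((c + κ n) / (2 * c))⁻¹ ^ 2
        - (-2 * ((c - κ n) / (2 * c))⁻¹ + ((c - κ n) / (2 * c))⁻¹ ^ 2)
        = -8 * (c * ((κ n ^ 3 + c ^ 2 * κ n) / (κ n ^ 2 - c ^ 2) ^ 2)) := by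
      field_simp
      ring
    simp only [hV, ← ofReal_inv, ← ofReal_pow, ofReal_re, Complex.norm_real, Real.norm_eq_abs]
    linear_combination Real.pi * (h1 / 8 + h6 / 32)
  have e3 : V (1 / 2) = Real.pi * (-Real.log 2 / 8) := by
    have : ((1 / 2 : ℂ)⁻¹) = ((2 : ℝ) : ℂ) := by norm_num
    simp only [hV]
    rw [this, ← ofReal_pow, ofReal_re, ofReal_re]
    have hl : Real.log (1 / 2) = -Real.log 2 := by rw [one_div, Real.log_inv]
    norm_num [hl]
  have e4 := sum_log_norm_roots hc hQ0
  have e5 : Real.log (4 * c) = Real.log 2 + Real.log (2 * c) := by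
    rw [← Real.log_mul (by norm_num) (by positivity)]; congr 1; ring
  rw [e1, e2, e3, e5]
  linear_combination Real.pi / 8 * e4

end TraceFormulas

lemma PieceData.IsPolyNodal.exists_traceParameters {S : HalfLineString} {c R : ℝ}
    {D : PieceData S R} {F G : ℕ → Polynomial ℝ} (h : D.IsPolyNodal c F G) (hc : 0 < c)
    (hR : 0 < R) (hw : ∀ᵐ x ∂volume.restrict (Ici R), S.w x = x / (1 + 2 * c * x)) :
    IntegrableOn (fun x : ℝ => S.w x - x / (1 + 2 * c * x)) (Ioi 0) ∧
    IntegrableOn (fun x : ℝ => |S.w x - x / (1 + 2 * c * x)| ^ 2 * (1 + 2 * c * x)) (Ioi 0) ∧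
    ∃ x y : ℝ, (jostPoly c F G).coeff 0 = -(2 * c) ∧ (jostPoly c F G).coeff 1 = 2 * c * x ∧
      (jostPoly c F G).coeff 2 = c * (y - x ^ 2) ∧
      2 - x = 4 * c ^ 2 * (∫ x in Ioi (0 : ℝ), (S.w x - x / (1 + 2 * c * x)))
        - Real.log (1 + 2 * c * R) ∧
      4 - y = 2 * (4 * c ^ 2 * (∫ x in Ioi (0 : ℝ), (S.w x - x / (1 + 2 * c * x)))
        - 8 * c ^ 3 * ((∫ x in Ioi (0 : ℝ),
            |S.w x - x / (1 + 2 * c * x)| ^ 2 * (1 + 2 * c * x))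
          + ∫ x in Ici 0, (1 + 2 * c * x) ∂S.υ)) := by
  obtain ⟨i1, j1⟩ := integrableOn_Ioi_and_integral_eq hR.le (S.integrableOn_defect hc R)
    (hw.mono fun x hx => by rw [hx, sub_self])
  obtain ⟨i2, j2⟩ := integrableOn_Ioi_and_integral_eq hR.le (S.integrableOn_defect_sq hc R)
    (hw.mono fun x hx => by rw [hx, sub_self]; simp)
  obtain ⟨q0, q1, q2⟩ := h.coeff_jostPoly hR hc
  have k1 := h.coeff_one_eq hR hc
  have k2 := h.coeff_two_eq hR hc
  rw [← j1] at k1 k2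
  rw [← j2] at k2
  -- Both values come from Q = 2c(σ - 1) F + G: -x and -y/2 are the first two Taylor coefficients of
  -- log(-Q/(2c)) at 0.
  refine ⟨i1, i2, 2 - (F 0).coeff 1, 4 - 2 * ((F 0).coeff 2 - (F 0).coeff 1 ^ 2 / 2
    - ((G 0).coeff 2 - 2 * c * (F 0).coeff 1) / (2 * c)), q0, q1, ?_, ?_, ?_⟩
  · rw [q2]; field_simp; ring
  · rw [← k1]; ring
  · rw [← k2]; ring

theorem lemma6p1 (α : ℝ) (hα : 0 < α) (S : HalfLineString) (R : ℝ) (hS : S.MemClassF α R) :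
    (∃ a : ℂ → ℂ, S.IsJostFunction α R a) ∧
    ∀ a : ℂ → ℂ, S.IsJostFunction α R a →
      (∃ (N : ℕ) (κ : Fin N → ℝ), IsUpperZeroEnumeration a κ) ∧
      ∀ (N : ℕ) (κ : Fin N → ℝ), IsUpperZeroEnumeration a κ →
        -- all expressions in the two identities are well-defined
        (∀ n, κ n ≠ √α) ∧
        Integrable (fun k : ℝ => 1 / (k ^ 2 + α) ^ 2 * Real.log ‖a k‖) ∧
        Integrable (fun k : ℝ => k ^ 2 / (k ^ 2 + α) ^ 3 * Real.log ‖a k‖) ∧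
        IntegrableOn (fun x : ℝ => S.w x - x / (1 + 2 * √α * x)) (Ioi 0) ∧
        IntegrableOn
          (fun x : ℝ => |S.w x - x / (1 + 2 * √α * x)| ^ 2 * (1 + 2 * √α * x)) (Ioi 0) ∧
        IntegrableOn (fun x : ℝ => 1 + 2 * √α * x) (Ici 0) S.υ ∧
        -- the first trace formula
        1 / √α * ∑ n, κ n / (κ n ^ 2 - α)
            + 1 / (2 * α) * ∑ n, Real.log |(κ n - √α) / (κ n + √α)|
            + √α / Real.pi * ∫ k : ℝ, 1 / (k ^ 2 + α) ^ 2 * Real.log ‖a k‖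
          = ∫ x in Ioi (0 : ℝ), (S.w x - x / (1 + 2 * √α * x)) ∧
        -- the second trace formula
        1 / (2 * α) * ∑ n, (κ n ^ 3 + α * κ n) / (κ n ^ 2 - α) ^ 2
            + 1 / (4 * α ^ (3 / 2 : ℝ)) * ∑ n, Real.log |(κ n - √α) / (κ n + √α)|
            + 2 / Real.pi * ∫ k : ℝ, k ^ 2 / (k ^ 2 + α) ^ 3 * Real.log ‖a k‖
          = (∫ x in Ioi (0 : ℝ), |S.w x - x / (1 + 2 * √α * x)| ^ 2 * (1 + 2 * √α * x))
            + ∫ x in Ici (0 : ℝ), (1 + 2 * √α * x) ∂S.υ := by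
  obtain ⟨D⟩ := hS.nonempty_pieceData
  obtain ⟨F, G, h⟩ := D.exists_isPolyNodal √α
  have hJ := h.isJostFunction hα hS
  refine ⟨⟨_, hJ⟩, fun a ha => ?_⟩
  have hR := hS.R_pos
  have haJ := ha.eqOn hJ
  have hc : 0 < √α := Real.sqrt_pos.2 hα
  obtain ⟨i1, i2, x, y, q0, q1, q2, hx, hy⟩ := h.exists_traceParameters hc hR hS.w_eq
  have hυ := D.integrableOn_υ fun x : ℝ => 1 + 2 * √α * x
  have him : ∀ σ : ℂ, σ.re < 1 / 2 → Polynomial.aeval σ (PieceData.jostPoly √α F G) = 0 → σ.im = 0 :=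
    fun σ => h.im_eq_zero hc hR
  generalize PieceData.jostPoly √α F G = Q at *
  have hcα : α = √α ^ 2 := (Real.sq_sqrt hα.le).symm
  have hα32 : α ^ (3 / 2 : ℝ) = √α ^ 3 := by
    rw [Real.sqrt_eq_rpow, ← Real.rpow_natCast, ← Real.rpow_mul hα.le]
    norm_num
  rw [hα32]
  generalize √α = c at *
  subst hcα
  have hQ0 : Q.coeff 0 ≠ 0 := by rw [q0]; simp [hc.ne']
  have hQ : Q ≠ 0 := by rintro rfl; simp at hQ0
  refine ⟨exists_isUpperZeroEnumeration hc hQ haJ ha.analytic him, fun N κ hκ => ?_⟩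
  obtain ⟨hκ0, hκQ⟩ := (isUpperZeroEnumeration_iff hc hQ haJ ha.analytic κ).1 hκ
  have hL := fun t ht hQt => log_norm_jostFunction hc haJ (t := t) ht hQt
  obtain ⟨m1, e1⟩ := integral_scale (g := fun k : ℝ => 1 / (k ^ 2 + c ^ 2) ^ 2 * Real.log ‖a k‖)
    -- Substituting k = ct turns k² + c² into c²(1 + t²). Both weights are homogeneous of degree -4
    -- in (k, c), hence the factor 1/c⁴.
    (d := 1 / c ^ 4) hc (fun t => by
      have : (c * t) ^ 2 + c ^ 2 = c ^ 2 * (1 + t ^ 2) := by ring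
      simp only [this]
      have : 1 + t ^ 2 ≠ 0 := by positivity
      field_simp) (first_kernel_integral hc hκ0 hκQ q0 q1 q2 hL)
  obtain ⟨m2, e2⟩ := integral_scale
    (g := fun k : ℝ => k ^ 2 / (k ^ 2 + c ^ 2) ^ 3 * Real.log ‖a k‖)
    (d := 1 / c ^ 4) hc (fun t => by
      have : (c * t) ^ 2 + c ^ 2 = c ^ 2 * (1 + t ^ 2) := by ring
      simp only [this]
      have : 1 + t ^ 2 ≠ 0 := by positivity
      field_simp) (second_kernel_integral hc hκ0 hκQ q0 q1 q2 hL)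
  refine ⟨ne_of_roots hQ0 hκQ, m1, m2, i1, i2, hυ, ?_, ?_⟩
  · rw [e1, hx]
    field_simp
    ring
  · rw [e2]
    -- In this combination the integral of the linear defect cancels, and the logarithm of 1 + 2cR
    -- left in 2(2 - x) cancels the one from (1 + 2cR)^σ. Only the quadratic defect and `υ` remain.
    have hxy : y - 2 * x = 2 * (2 - x) - (4 - y) := by ring
    rw [hxy, hx, hy]
    field_simp
    ring
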